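/- Let $K$ be an algebraically closed field of characteristic $0$, let $G$ be a finite group acting linearly on a finite-dimensional $K$-vector space $Y$, and let $S=K[Y]=\bigoplus_{d\ge 0}S_d$ be the coordinate ring of $Y$ with its standard grading, so that the invariant ring $S^G=\bigoplus_{d\ge 0}(S^G)_d$ is a graded $K$-algebra. For a homogeneous ideal (that is, a graded $S^G$-submodule) $N\subseteq S^G$ let $H(N,t)=\sum_{d\ge 0}\dim_K(N\cap S_d)\,t^d\in\mathbb{Z}[[t]]$ be its Hilbert series. The universal denominator of $H(S^G,t)$ is the unique smallest (with respect to divisibility) polynomial $B(t)\in\mathbb{Z}[t]$ such that $B(0)=1$ and $B(t)H(N,t)$ is a polynomial for every homogeneous ideal $N\subseteq S^G$. Then the universal denominator of $H(S^G,t)$ exists, and, viewed in $K[t]$, it is equal to $$\operatorname{lcm}\{\det(\operatorname{id}-t\,g)\mid g\in G\},$$ the least common multiple in $K[t]$, normalized to have constant term $1$, of the determinants of the endomorphisms $\operatorname{id}-t\,g$ of $Y$, where $t$ is an indeterminate. -/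

import Mathlib

open Polynomial TensorProduct

noncomputable section

/-! ### Universal denominators of graded algebras -/

section UniversalDenominator

variable {K A : Type*} [Field K] [CommRing A] [Algebra K A]

/-- The Hilbert series `∑ d, dim (I ∩ A_d) t ^ d` of a homogeneous ideal `I` of an `ℕ`-graded
`K`-algebra `A = ⨁ d, A_d` with finite-dimensional homogeneous components. -/
def hilbertSeries (𝒜 : ℕ → Submodule K A) (I : Ideal A) : PowerSeries ℤ :=
  PowerSeries.mk fun d => (Module.finrank K ↥(I.restrictScalars K ⊓ 𝒜 d) : ℤ)

/-- `B(t)` has constant term `1`, and `B(t) H(I, t)` is a polynomial for every graded submodule `I`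
of the graded algebra `A`, regarded as a module over itself. All the Hilbert series in question
are power series, so "Laurent polynomial" and "polynomial" mean the same here. -/
def IsCommonDenominator (𝒜 : ℕ → Submodule K A) [GradedAlgebra 𝒜] (B : ℤ[X]) : Prop :=
  B.coeff 0 = 1 ∧
    ∀ I : Ideal A, I.IsHomogeneous 𝒜 →
      ∃ P : ℤ[X], (B : PowerSeries ℤ) * hilbertSeries 𝒜 I = (P : PowerSeries ℤ)

/-- `B(t)` is the universal denominator of `H(A, t)`: the smallest polynomial, with respect to
divisibility, among the common denominators of the Hilbert series of all graded submodules. -/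
def IsUniversalDenominator (𝒜 : ℕ → Submodule K A) [GradedAlgebra 𝒜] (B : ℤ[X]) : Prop :=
  IsCommonDenominator 𝒜 B ∧ ∀ B' : ℤ[X], IsCommonDenominator 𝒜 B' → B ∣ B'

theorem IsUniversalDenominator.unique {𝒜 : ℕ → Submodule K A} [GradedAlgebra 𝒜] {B B' : ℤ[X]}
    (h : IsUniversalDenominator 𝒜 B) (h' : IsUniversalDenominator 𝒜 B') : B = B' := by
  obtain ⟨u, hu⟩ := associated_of_dvd_dvd (h.2 B' h'.1) (h'.2 B h.1)
  obtain ⟨c, -, hc⟩ := Polynomial.isUnit_iff.1 u.isUnit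
  have h1 := h'.1.1
  rw [← hu, ← hc, Polynomial.coeff_mul_C, h.1.1, one_mul] at h1
  rw [← hu, ← hc, h1, map_one, mul_one]

end UniversalDenominator

/-- `m` is a least common multiple of the set `s`. -/
def IsLeastCommonMultiple {R : Type*} [CommRing R] (s : Set R) (m : R) : Prop :=
  (∀ a ∈ s, a ∣ m) ∧ ∀ n : R, (∀ a ∈ s, a ∣ n) → m ∣ n

/-! ### The coordinate ring of a vector space and its grading -/

section CoordinateRing

variable (K Y : Type*) [Field K] [AddCommGroup Y] [Module K Y]

/-- The coordinate ring `K[Y]`, as the symmetric algebra of the dual space. -/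
def CoordinateRing : Type _ := SymmetricAlgebra K (Module.Dual K Y)

instance : CommRing (CoordinateRing K Y) :=
  inferInstanceAs (CommRing (SymmetricAlgebra K (Module.Dual K Y)))

instance : Algebra K (CoordinateRing K Y) :=
  inferInstanceAs (Algebra K (SymmetricAlgebra K (Module.Dual K Y)))

/-- The linear forms on `Y`, as elements of `K[Y]`. -/
def linearForm : Module.Dual K Y →ₗ[K] CoordinateRing K Y :=
  SymmetricAlgebra.ι K (Module.Dual K Y)

variable {K Y} in
/-- The universal property of `K[Y]`: algebra maps out of it are determined by their values on
linear forms, which are arbitrary. -/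
def coordinateRingLift {A : Type*} [CommSemiring A] [Algebra K A] (φ : Module.Dual K Y →ₗ[K] A) :
    CoordinateRing K Y →ₐ[K] A :=
  SymmetricAlgebra.lift φ

variable {K Y} in
theorem coordinateRingLift_linearForm {A : Type*} [CommSemiring A] [Algebra K A]
    (φ : Module.Dual K Y →ₗ[K] A) (m : Module.Dual K Y) :
    coordinateRingLift φ (linearForm K Y m) = φ m :=
  SymmetricAlgebra.lift_ι_apply φ m

variable {K Y} in
theorem coordinateRing_algHom_ext {A : Type*} [CommSemiring A] [Algebra K A]
    {F F' : CoordinateRing K Y →ₐ[K] A}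
    (h : ∀ m, F (linearForm K Y m) = F' (linearForm K Y m)) : F = F' :=
  SymmetricAlgebra.algHom_ext (LinearMap.ext h)

/-- The space `K[Y]_d` of forms of degree `d`, spanned by the products of `d` linear forms. -/
def coordinateRingDegree (d : ℕ) : Submodule K (CoordinateRing K Y) :=
  LinearMap.range (linearForm K Y) ^ d

instance coordinateRing_gradedMonoid : SetLike.GradedMonoid (coordinateRingDegree K Y) :=
  Submodule.nat_power_gradedMonoid (LinearMap.range (linearForm K Y))

/-- The linear forms, placed in degree `1`. -/
def coordinateRingGradedι :
    Module.Dual K Y →ₗ[K] DirectSum ℕ fun d => ↥(coordinateRingDegree K Y d) :=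
  DirectSum.lof K ℕ (fun d => ↥(coordinateRingDegree K Y d)) 1 ∘ₗ
    (linearForm K Y).codRestrict _ fun m => by
      simp [coordinateRingDegree]

theorem coordinateRingGradedι_apply (m : Module.Dual K Y) :
    coordinateRingGradedι K Y m =
      DirectSum.of (fun d => ↥(coordinateRingDegree K Y d)) 1
        ⟨linearForm K Y m, by simp [coordinateRingDegree]⟩ :=
  rfl

instance coordinateRing_gradedAlgebra : GradedAlgebra (coordinateRingDegree K Y) :=
  GradedAlgebra.ofAlgHom _ (coordinateRingLift <| coordinateRingGradedι K Y)
    (by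
      refine coordinateRing_algHom_ext fun m => ?_
      rw [AlgHom.comp_apply, coordinateRingLift_linearForm, coordinateRingGradedι_apply,
        DirectSum.coeAlgHom_of, AlgHom.id_apply])
    fun i x => by
      obtain ⟨x, hx⟩ := x
      dsimp only [Subtype.coe_mk]
      unfold coordinateRingDegree at hx
      induction hx using Submodule.pow_induction_on_left' with
      | algebraMap r =>
        rw [AlgHom.commutes, DirectSum.algebraMap_apply]; rfl
      | add x y i hx hy ihx ihy =>
        rw [map_add, ihx, ihy, ← map_add]
        rfl
      | mem_mul m hm i x hx ih =>
        obtain ⟨_, rfl⟩ := hm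
        rw [map_mul, ih, coordinateRingLift_linearForm, coordinateRingGradedι_apply,
          DirectSum.of_mul_of]
        exact DirectSum.of_eq_of_gradedMonoid_eq (Sigma.subtype_ext (add_comm _ _) rfl)

end CoordinateRing

/-! ### Invariants -/

section Invariants

variable {K G Y : Type*} [Field K] [Group G] [AddCommGroup Y] [Module K Y]

/-- The action of `g` on `K[Y]`; on linear forms it is `f ↦ f ∘ g⁻¹`. -/
def coordinateRingAct (ρ : Representation K G Y) (g : G) :
    CoordinateRing K Y →ₐ[K] CoordinateRing K Y :=
  coordinateRingLift (linearForm K Y ∘ₗ ρ.dual g)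

/-- The invariant ring `K[Y]^G`. -/
def invariantRing (ρ : Representation K G Y) : Subalgebra K (CoordinateRing K Y) :=
  ⨅ g : G, AlgHom.equalizer (coordinateRingAct ρ g) (AlgHom.id K (CoordinateRing K Y))

/-- The space `(K[Y]^G)_d` of invariant forms of degree `d`. -/
def invariantRingDegree (ρ : Representation K G Y) (d : ℕ) : Submodule K ↥(invariantRing ρ) :=
  (coordinateRingDegree K Y d).comap (invariantRing ρ).val.toLinearMap

theorem mem_invariantRing {ρ : Representation K G Y} {f : CoordinateRing K Y} :
    f ∈ invariantRing ρ ↔ ∀ g, coordinateRingAct ρ g f = f := by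
  simp [invariantRing, Algebra.mem_iInf, AlgHom.mem_equalizer]

theorem coordinateRingAct_mem (ρ : Representation K G Y) (g : G) {d : ℕ}
    {f : CoordinateRing K Y} (hf : f ∈ coordinateRingDegree K Y d) :
    coordinateRingAct ρ g f ∈ coordinateRingDegree K Y d := by
  have h : (coordinateRingDegree K Y d).map (coordinateRingAct ρ g).toLinearMap ≤
      coordinateRingDegree K Y d := by
    unfold coordinateRingDegree
    rw [Submodule.map_pow]
    refine pow_le_pow_left' ?_ d
    rintro _ ⟨_, ⟨m, rfl⟩, rfl⟩
    exact ⟨ρ.dual g m, (coordinateRingLift_linearForm (linearForm K Y ∘ₗ ρ.dual g) m).symm⟩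
  exact h ⟨f, hf, rfl⟩

theorem decompose_mem_invariantRing (ρ : Representation K G Y) {f : CoordinateRing K Y}
    (hf : f ∈ invariantRing ρ) (d : ℕ) :
    (DirectSum.decompose (coordinateRingDegree K Y) f d : CoordinateRing K Y) ∈
      invariantRing ρ := by
  rw [mem_invariantRing] at hf ⊢
  intro g
  have key : ∀ f : CoordinateRing K Y,
      (DirectSum.decompose (coordinateRingDegree K Y) (coordinateRingAct ρ g f) d :
        CoordinateRing K Y) =
      coordinateRingAct ρ g (DirectSum.decompose (coordinateRingDegree K Y) f d) := by
    intro f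
    induction f using DirectSum.Decomposition.inductionOn (coordinateRingDegree K Y) with
    | zero => simp
    | @homogeneous i m =>
      by_cases h : i = d
      · subst h
        rw [DirectSum.decompose_of_mem_same _ (coordinateRingAct_mem ρ g m.2),
          DirectSum.decompose_of_mem_same _ m.2]
      · rw [DirectSum.decompose_of_mem_ne _ (coordinateRingAct_mem ρ g m.2) h,
          DirectSum.decompose_of_mem_ne _ m.2 h, map_zero]
    | add m m' h h' => simp [h, h']
  rw [← key, hf g]

instance invariantRing_gradedMonoid (ρ : Representation K G Y) :
    SetLike.GradedMonoid (invariantRingDegree ρ) where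
  one_mem := SetLike.GradedOne.one_mem (A := coordinateRingDegree K Y)
  mul_mem _ _ _ _ h h' := SetLike.GradedMul.mul_mem (A := coordinateRingDegree K Y) h h'

/-- The homogeneous components of an invariant. -/
def invariantRingDecompose (ρ : Representation K G Y) (f : invariantRing ρ) :
    DirectSum ℕ fun d => ↥(invariantRingDegree ρ d) := by
  classical
  exact DirectSum.mk (fun d => ↥(invariantRingDegree ρ d))
    (DirectSum.decompose (coordinateRingDegree K Y) (f : CoordinateRing K Y)).support
    fun d => ⟨⟨_, decompose_mem_invariantRing ρ f.2 d⟩,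
      (DirectSum.decompose (coordinateRingDegree K Y) (f : CoordinateRing K Y) d).2⟩

theorem invariantRingDecompose_apply (ρ : Representation K G Y) (f : invariantRing ρ) (d : ℕ) :
    ((invariantRingDecompose ρ f d : invariantRing ρ) : CoordinateRing K Y) =
      DirectSum.decompose (coordinateRingDegree K Y) (f : CoordinateRing K Y) d := by
  classical
  unfold invariantRingDecompose
  by_cases h : d ∈ (DirectSum.decompose (coordinateRingDegree K Y)
      (f : CoordinateRing K Y)).support
  · rw [DirectSum.mk_apply_of_mem h]
  · rw [DirectSum.mk_apply_of_notMem h]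
    rw [DFinsupp.notMem_support_iff] at h
    simp [h]

theorem decompose_coe_invariantRing (ρ : Representation K G Y)
    (x : DirectSum ℕ fun d => ↥(invariantRingDegree ρ d)) (d : ℕ) :
    (DirectSum.decompose (coordinateRingDegree K Y)
      ((DirectSum.coeAddMonoidHom (invariantRingDegree ρ) x : invariantRing ρ) :
        CoordinateRing K Y) d : CoordinateRing K Y) =
      ((x d : invariantRing ρ) : CoordinateRing K Y) := by
  induction x using DirectSum.induction_on with
  | zero =>
    rw [AddMonoidHom.map_zero, ZeroMemClass.coe_zero, DirectSum.decompose_zero]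
    rfl
  | of i m =>
    rw [DirectSum.coeAddMonoidHom_of]
    by_cases h : i = d
    · subst h
      have hm : ((m : invariantRing ρ) : CoordinateRing K Y) ∈ coordinateRingDegree K Y i := m.2
      rw [DirectSum.decompose_of_mem_same _ hm, DirectSum.of_eq_same]
    · have hm : ((m : invariantRing ρ) : CoordinateRing K Y) ∈ coordinateRingDegree K Y i := m.2
      rw [DirectSum.decompose_of_mem_ne _ hm h, DirectSum.of_eq_of_ne _ _ _ (Ne.symm h)]
      rfl
  | add x y hx hy =>
    rw [AddMonoidHom.map_add, Subalgebra.coe_add, DirectSum.decompose_add, DirectSum.add_apply,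
      Submodule.coe_add, hx, hy, DirectSum.add_apply]
    rfl

instance invariantRing_decomposition (ρ : Representation K G Y) :
    DirectSum.Decomposition (invariantRingDegree ρ) where
  decompose' := invariantRingDecompose ρ
  left_inv f := by
    apply Subtype.ext
    apply (DirectSum.decompose (coordinateRingDegree K Y)).injective
    refine DFinsupp.ext fun d => Subtype.ext ?_
    rw [decompose_coe_invariantRing, invariantRingDecompose_apply]
  right_inv x := by
    refine DFinsupp.ext fun d => Subtype.ext (Subtype.ext ?_)
    rw [invariantRingDecompose_apply, decompose_coe_invariantRing]

instance invariantRing_gradedAlgebra (ρ : Representation K G Y) :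
    GradedAlgebra (invariantRingDegree ρ) where

/-- `det (id - t g)`, computed over the polynomial ring `K[t]`. -/
def detOneSub (ρ : Representation K G Y) (g : G) : K[X] :=
  LinearMap.det (LinearMap.id - (X : K[X]) • (ρ g).baseChange K[X])

end Invariants

end

/-! Let `M w` be the largest dimension of the `w`-eigenspace of an element of `G`. As every `g` is
semisimple, the multiplicity of `w` as a root of `det (id - t g)` is the dimension of the
`w`-eigenspace of `g⁻¹`, so the least common multiple is the polynomial with every `w` as a root of
multiplicity `M w`. Passing to powers of `g` shows that `M w` depends only on the order of `w`, so
this polynomial is up to sign a product of cyclotomic polynomials, hence integral.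

It is a common denominator. Fix `w`. The homogeneous invariants of degrees `d` with `w ^ d ≠ 1`
vanish at `y` precisely when no invariant separates `y` from `w • y`, that is, when `y` is a
`w`-eigenvector of some `g`. By the Nullstellensatz finitely many of them, completed by `M w` norms
of generic linear forms, generate an ideal containing all invariants of large degree. The
Hilbert–Serre argument then gives a denominator `∏ (1 - t ^ d i)` in which only the `M w` norms
contribute to the root `w`.

It divides every common denominator. If `V` is the `w`-eigenspace of `g`, the image of `S^G` in
`K[V]` lives in the degrees `d` with `w ^ d = 1`, so its Hilbert series is invariant under
`t ↦ w t` and has the same pole order at `w` as at `1`. As `K[V]` is integral over this image, the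
image contains `dim V` algebraically independent homogeneous elements, and comparison with the
polynomial ring they generate shows that the pole at `1` has order at least `dim V`.
-/

section Polynomials

variable {K : Type*} [Field K]

theorem dvd_of_rootMultiplicity_le [IsAlgClosed K] {p q : K[X]} (hp : p ≠ 0)
    (h : ∀ w, p.rootMultiplicity w ≤ q.rootMultiplicity w) : p ∣ q := by
  classical
  refine (IsAlgClosed.splits p).dvd_of_roots_le_roots hp (Multiset.le_iff_count.2 fun w => ?_)
  simpa only [count_roots] using h w

theorem dvd_of_map_dvd_map {R : Type*} [CommRing R] {f : R →+* K} (hf : Function.Injective f)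
    {p q : R[X]} (hp : IsUnit p.leadingCoeff) (h : p.map f ∣ q.map f) : p ∣ q := by
  obtain ⟨u, hu⟩ := hp
  have hmonic : (C (↑u⁻¹ : R) * p).Monic :=
    monic_C_mul_of_mul_leadingCoeff_eq_one (by rw [← hu, Units.inv_mul])
  have hunit : IsUnit (C (f ↑u⁻¹)) := isUnit_C.2 (u⁻¹.isUnit.map f)
  refine (dvd_mul_left p _).trans ((map_dvd_map f hf hmonic).1 ?_)
  rwa [Polynomial.map_mul, map_C, hunit.mul_left_dvd]

theorem rootMultiplicity_prod {R ι : Type*} [CommRing R] [IsDomain R] (s : Finset ι) {f : ι → R[X]}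
    (hf : ∀ i ∈ s, f i ≠ 0) (w : R) :
    (∏ i ∈ s, f i).rootMultiplicity w = ∑ i ∈ s, (f i).rootMultiplicity w := by
  classical
  rw [← count_roots, roots_prod _ _ (Finset.prod_ne_zero_iff.2 hf), Multiset.count_bind]
  simp only [count_roots]
  rfl

theorem rootMultiplicity_eq_ite_of_separable [DecidableEq K] {p : K[X]} (hp : p.Separable) (w : K) :
    p.rootMultiplicity w = if p.IsRoot w then 1 else 0 := by
  split_ifs with h
  · exact le_antisymm (rootMultiplicity_le_one_of_separable hp w)
      ((rootMultiplicity_pos hp.ne_zero).2 h)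
  · exact rootMultiplicity_eq_zero h

theorem separable_one_sub_X_pow {d : ℕ} (hd : (d : K) ≠ 0) : (1 - X ^ d : K[X]).Separable := by
  rw [← neg_sub, ← neg_one_mul]
  exact (X_pow_sub_one_separable_iff.2 hd).unit_mul isUnit_one.neg

theorem rootMultiplicity_prod_one_sub_X_pow [DecidableEq K] {ι : Type*} [Fintype ι] {d : ι → ℕ}
    (hd : ∀ i, (d i : K) ≠ 0) (w : K) :
    (∏ i, (1 - X ^ d i : K[X])).rootMultiplicity w = Fintype.card {i // w ^ d i = 1} := by
  rw [rootMultiplicity_prod _ fun i _ => (separable_one_sub_X_pow (hd i)).ne_zero,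
    Fintype.card_subtype, Finset.card_filter]
  refine Finset.sum_congr rfl fun i _ => ?_
  rw [rootMultiplicity_eq_ite_of_separable (separable_one_sub_X_pow (hd i))]
  simp [sub_eq_zero, eq_comm (a := (1 : K))]

variable [CharZero K]

theorem rootMultiplicity_prod_cyclotomic_pow {s : Finset ℕ} (hs : 0 ∉ s)
    (m : ℕ → ℕ) (w : K) :
    (∏ k ∈ s, cyclotomic k K ^ m k).rootMultiplicity w =
      if orderOf w ∈ s then m (orderOf w) else 0 := by
  classical
  have hk : ∀ k ∈ s, ((cyclotomic k K) ^ m k).rootMultiplicity w =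
      if orderOf w = k then m k else 0 := by
    intro k hk
    have hk0 : 0 < k := Nat.pos_of_ne_zero fun h => hs (h ▸ hk)
    have : NeZero (k : K) := ⟨Nat.cast_ne_zero.2 hk0.ne'⟩
    have hiff : (cyclotomic k K).IsRoot w ↔ orderOf w = k := by
      rw [isRoot_cyclotomic_iff, IsPrimitiveRoot.iff_orderOf]
    rw [← count_roots, roots_pow, Multiset.count_nsmul, count_roots,
      rootMultiplicity_eq_ite_of_separable (separable_cyclotomic k K)]
    simp only [hiff, mul_ite, mul_one, mul_zero]
  rw [rootMultiplicity_prod s fun k _ => pow_ne_zero _ (cyclotomic_ne_zero k K),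
    Finset.sum_congr rfl hk, Finset.sum_ite_eq]

theorem isUnit_coeff_zero_cyclotomic (k : ℕ) : IsUnit ((cyclotomic k ℤ).coeff 0) := by
  obtain hk | rfl | hk := Nat.lt_trichotomy k 1
  · simp [Nat.lt_one_iff.1 hk]
  · simp
  · simp [cyclotomic_coeff_zero ℤ hk]

theorem exists_int_polynomial_rootMultiplicity_eq {M : K → ℕ} {n : ℕ} (hn : n ≠ 0)
    (hM : ∀ w, w ^ n ≠ 1 → M w = 0) (hM' : Function.FactorsThrough M orderOf) :
    ∃ B : ℤ[X], IsUnit B.leadingCoeff ∧ B.coeff 0 = 1 ∧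
      ∀ w, (B.map (Int.castRingHom K)).rootMultiplicity w = M w := by
  classical
  set m : ℕ → ℕ := Function.extend orderOf M 0
  set P : ℤ[X] := ∏ k ∈ n.divisors, cyclotomic k ℤ ^ m k
  have hP : P.Monic := monic_prod_of_monic _ _ fun k _ => (cyclotomic.monic k ℤ).pow _
  have hP0 : IsUnit (P.coeff 0) := by
    rw [coeff_zero_eq_eval_zero, eval_prod]
    refine Finset.prod_induction _ IsUnit (fun _ _ => IsUnit.mul) isUnit_one fun k _ => ?_
    rw [eval_pow, ← coeff_zero_eq_eval_zero]
    exact (isUnit_coeff_zero_cyclotomic k).pow _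
  refine ⟨C (P.coeff 0) * P, ?_, ?_, fun w => ?_⟩
  · rwa [leadingCoeff_mul, leadingCoeff_C, hP.leadingCoeff, mul_one]
  · rw [coeff_C_mul, Int.isUnit_mul_self hP0]
  · have hmap : P.map (Int.castRingHom K) = ∏ k ∈ n.divisors, cyclotomic k K ^ m k := by
      simp only [P, Polynomial.map_prod, Polynomial.map_pow, map_cyclotomic]
    rw [Polynomial.map_mul, map_C, ← count_roots,
      roots_C_mul _ (hP0.map (Int.castRingHom K)).ne_zero, count_roots, hmap,
      rootMultiplicity_prod_cyclotomic_pow (by simp), show m (orderOf w) = M w from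
        hM'.extend_apply 0 w, ite_eq_left_iff, Nat.mem_divisors, orderOf_dvd_iff_pow_eq_one,
      and_iff_left hn]
    exact fun hw => (hM w hw).symm

end Polynomials

section Denominators

/-- The polynomials `B` for which the power series `B F` is a polynomial. -/
noncomputable def denominatorIdeal {R : Type*} [CommRing R] (F : PowerSeries R) : Ideal R[X] :=
  (LinearMap.range (Algebra.linearMap R[X] (PowerSeries R))).comap
    (LinearMap.toSpanSingleton R[X] (PowerSeries R) F)

section CommRing

variable {R : Type*} [CommRing R] {B D : R[X]} {F G : PowerSeries R}

theorem mem_denominatorIdeal : B ∈ denominatorIdeal F ↔ ∃ P : R[X], (B : PowerSeries R) * F = P :=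
  exists_congr fun _ => eq_comm

theorem mem_denominatorIdeal_iff_exists_coeff_eq_zero :
    B ∈ denominatorIdeal F ↔ ∃ n, ∀ d ≥ n, ((B : PowerSeries R) * F).coeff d = 0 := by
  rw [mem_denominatorIdeal]
  constructor
  · rintro ⟨P, hP⟩
    refine ⟨P.natDegree + 1, fun d hd => ?_⟩
    rw [hP, coeff_coe, coeff_eq_zero_of_natDegree_lt hd]
  · rintro ⟨n, hn⟩
    refine ⟨((B : PowerSeries R) * F).trunc n, PowerSeries.ext fun d => ?_⟩
    rw [coeff_coe, PowerSeries.coeff_trunc]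
    split_ifs with hd
    · rfl
    · exact hn d (not_lt.1 hd)

theorem denominatorIdeal_inf_le_sub :
    denominatorIdeal F ⊓ denominatorIdeal G ≤ denominatorIdeal (F - G) := by
  rintro B ⟨hF, hG⟩
  obtain ⟨P, hP⟩ := mem_denominatorIdeal.1 hF
  obtain ⟨Q, hQ⟩ := mem_denominatorIdeal.1 hG
  exact mem_denominatorIdeal.2 ⟨P - Q, by rw [mul_sub, hP, hQ, coe_sub]⟩

theorem mul_mem_denominatorIdeal :
    B * D ∈ denominatorIdeal F ↔ B ∈ denominatorIdeal ((D : PowerSeries R) * F) := by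
  simp only [mem_denominatorIdeal, coe_mul, mul_assoc]

theorem denominatorIdeal_le_mul (D : R[X]) :
    denominatorIdeal F ≤ denominatorIdeal ((D : PowerSeries R) * F) :=
  fun _ hB => mul_mem_denominatorIdeal.1 (Ideal.mul_mem_right D _ hB)

theorem map_mem_denominatorIdeal {S : Type*} [CommRing S] {f : R →+* S}
    (hf : Function.Injective f) :
    B.map f ∈ denominatorIdeal (F.map f) ↔ B ∈ denominatorIdeal F := by
  simp only [mem_denominatorIdeal_iff_exists_coeff_eq_zero, polynomial_map_coe, ← map_mul,
    PowerSeries.coeff_map, map_eq_zero_iff f hf]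

end CommRing

theorem mem_denominatorIdeal_of_rootMultiplicity_le {K : Type*} [Field K] [IsAlgClosed K]
    {B : K[X]} {F : PowerSeries K}
    (h : ∀ w, ∃ D ∈ denominatorIdeal F, D ≠ 0 ∧ D.rootMultiplicity w ≤ B.rootMultiplicity w) :
    B ∈ denominatorIdeal F := by
  let E := Submodule.IsPrincipal.generator (denominatorIdeal F)
  have dvd_of_mem {D : K[X]} (hD : D ∈ denominatorIdeal F) : E ∣ D :=
    (Submodule.IsPrincipal.mem_iff_generator_dvd _).1 hD
  have hE0 : E ≠ 0 := by
    obtain ⟨D, hD, hD0, -⟩ := h 0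
    exact ne_zero_of_dvd_ne_zero hD0 (dvd_of_mem hD)
  refine (Submodule.IsPrincipal.mem_iff_generator_dvd _).2
    (dvd_of_rootMultiplicity_le hE0 fun w => ?_)
  obtain ⟨D, hD, hD0, hw⟩ := h w
  exact (rootMultiplicity_le_rootMultiplicity_of_dvd hD0 (dvd_of_mem hD) w).trans hw

end Denominators

section HilbertSerre

theorem finrank_map_add_finrank_inf_ker {K V V' : Type*} [Field K] [AddCommGroup V] [Module K V]
    [AddCommGroup V'] [Module K V'] (W : Submodule K V) [FiniteDimensional K W] (f : V →ₗ[K] V') :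
    Module.finrank K (W.map f) + Module.finrank K ↥(W ⊓ LinearMap.ker f) = Module.finrank K W := by
  rw [← (f.domRestrict W).finrank_range_add_finrank_ker, LinearMap.range_domRestrict,
    LinearMap.ker_domRestrict, ← Submodule.map_comap_subtype, Submodule.finrank_map_subtype_eq]

theorem finrank_sup_map_add_finrank_inf_comap {K V V' : Type*} [Field K] [AddCommGroup V]
    [Module K V] [AddCommGroup V'] [Module K V'] (W : Submodule K V) [FiniteDimensional K W]
    (P : Submodule K V') [FiniteDimensional K P] (g : V →ₗ[K] V') :
    Module.finrank K ↥(P ⊔ W.map g) + Module.finrank K ↥(W ⊓ P.comap g) =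
      Module.finrank K P + Module.finrank K W := by
  have hsup := finrank_map_add_finrank_inf_ker (P ⊔ W.map g) P.mkQ
  have hW := finrank_map_add_finrank_inf_ker W (P.mkQ ∘ₗ g)
  rw [Submodule.map_sup, Submodule.ker_mkQ, inf_eq_right.2 le_sup_left, Submodule.mkQ_map_self,
    bot_sup_eq] at hsup
  rw [Submodule.map_comp, LinearMap.ker_comp, Submodule.ker_mkQ] at hW
  omega

variable {K A : Type*} [Field K] [CommRing A] [Algebra K A]

/-- The homogeneous elements of degree `d` of an ideal `I`, as in the definition of
`hilbertSeries`. -/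
abbrev idealDegree (𝒜 : ℕ → Submodule K A) (I : Ideal A) (d : ℕ) : Submodule K A :=
  I.restrictScalars K ⊓ 𝒜 d

theorem coeff_hilbertSeries (𝒜 : ℕ → Submodule K A) (I : Ideal A) (d : ℕ) :
    (hilbertSeries 𝒜 I).coeff d = Module.finrank K (idealDegree 𝒜 I d) :=
  PowerSeries.coeff_mk _ _

theorem hilbertSeries_bot (𝒜 : ℕ → Submodule K A) : hilbertSeries 𝒜 ⊥ = 0 := by
  ext d
  rw [coeff_hilbertSeries, idealDegree, Submodule.restrictScalars_bot, bot_inf_eq, finrank_bot,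
    Nat.cast_zero, map_zero]

variable {𝒜 : ℕ → Submodule K A} [GradedAlgebra 𝒜] {I J N N' : Ideal A} {a : A} {d e : ℕ}

theorem idealDegree_sup (hI : I.IsHomogeneous 𝒜) (hJ : J.IsHomogeneous 𝒜) (d : ℕ) :
    idealDegree 𝒜 (I ⊔ J) d = idealDegree 𝒜 I d ⊔ idealDegree 𝒜 J d := by
  refine le_antisymm ?_ (sup_le (inf_le_inf_right _ fun x hx => Ideal.mem_sup_left hx)
    (inf_le_inf_right _ fun x hx => Ideal.mem_sup_right hx))
  rintro x ⟨hx, hxd⟩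
  obtain ⟨y, hy, z, hz, rfl⟩ := Submodule.mem_sup.1 hx
  rw [← DirectSum.decompose_of_mem_same 𝒜 hxd, DirectSum.decompose_add, DirectSum.add_apply,
    Submodule.coe_add]
  exact Submodule.add_mem_sup ⟨hI d hy, SetLike.coe_mem _⟩ ⟨hJ d hz, SetLike.coe_mem _⟩

theorem idealDegree_span_singleton_mul (hN : N.IsHomogeneous 𝒜) (ha : a ∈ 𝒜 d) (e : ℕ) :
    idealDegree 𝒜 (Ideal.span {a} * N) (d + e) =
      (idealDegree 𝒜 N e).map (LinearMap.mulLeft K a) := by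
  ext x
  constructor
  · rintro ⟨hx, hxd⟩
    obtain ⟨y, hy, rfl⟩ := Ideal.mem_span_singleton_mul.1 hx
    refine ⟨DirectSum.decompose 𝒜 y e, ⟨hN e hy, SetLike.coe_mem _⟩, ?_⟩
    rw [LinearMap.mulLeft_apply, ← DirectSum.coe_decompose_mul_add_of_left_mem 𝒜 ha,
      DirectSum.decompose_of_mem_same 𝒜 hxd]
  · rintro ⟨y, ⟨hy, hye⟩, rfl⟩
    exact ⟨Ideal.mul_mem_mul (Ideal.mem_span_singleton_self a) hy, SetLike.GradedMul.mul_mem ha hye⟩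

theorem idealDegree_span_singleton_mul_of_lt (N : Ideal A) (ha : a ∈ 𝒜 d) (he : e < d) :
    idealDegree 𝒜 (Ideal.span {a} * N) e = ⊥ := by
  refine eq_bot_iff.2 ?_
  rintro x ⟨hx, hxe⟩
  obtain ⟨y, -, rfl⟩ := Ideal.mem_span_singleton_mul.1 hx
  rw [← DirectSum.decompose_of_mem_same 𝒜 hxe,
    DirectSum.coe_decompose_mul_of_left_mem_of_not_le 𝒜 ha he.not_ge]
  exact zero_mem _

theorem isHomogeneous_colon_singleton (hN : N.IsHomogeneous 𝒜) (ha : a ∈ 𝒜 d) :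
    (N.colon {a}).IsHomogeneous 𝒜 := by
  intro i x hx
  rw [Submodule.mem_colon_singleton, smul_eq_mul] at hx ⊢
  rw [← DirectSum.coe_decompose_mul_add_of_right_mem 𝒜 ha]
  exact hN _ hx

theorem isHomogeneous_span_singleton_mul (hN : N.IsHomogeneous 𝒜) (ha : a ∈ 𝒜 d) :
    (Ideal.span {a} * N).IsHomogeneous 𝒜 :=
  (Ideal.homogeneous_span 𝒜 _ (by rintro _ rfl; exact ⟨d, ha⟩)).mul hN

theorem exists_idealDegree_le_mul [IsNoetherianRing A] (hN : N.IsHomogeneous 𝒜) {n : ℕ}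
    (hJ : ∀ e ≥ n, 𝒜 e ≤ J.restrictScalars K) :
    ∃ m, ∀ e ≥ m, idealDegree 𝒜 N e ≤ (J * N).restrictScalars K := by
  classical
  obtain ⟨S, rfl⟩ := (Ideal.IsHomogeneous.iff_exists 𝒜 N).1 hN
  obtain ⟨T, hTS, hT⟩ := (Submodule.fg_span_iff_fg_span_finset_subset _).1
    (IsNoetherian.noetherian (Ideal.span ((↑) '' S : Set A)))
  rw [Ideal.span, hT]
  have homogeneous_of_mem : ∀ y ∈ T, ∃ j, y ∈ 𝒜 j := by
    intro y hy
    obtain ⟨s, -, rfl⟩ := hTS hy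
    exact s.2
  choose! deg hdeg using homogeneous_of_mem
  refine ⟨T.sup deg + n, fun e he x hx => ?_⟩
  rw [← DirectSum.decompose_of_mem_same 𝒜 hx.2]
  replace hx := hx.1
  induction hx using Submodule.closure_induction with
  | zero => simp
  | add x y _ _ hx hy =>
    rw [DirectSum.decompose_add, DirectSum.add_apply, Submodule.coe_add]
    exact add_mem hx hy
  | smul_mem c y hy =>
    have hdeg_le : deg y + n ≤ e := (Nat.add_le_add_right (Finset.le_sup hy) n).trans he
    rw [smul_eq_mul, DirectSum.coe_decompose_mul_of_right_mem_of_le 𝒜 (hdeg y hy) (by omega)]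
    exact Ideal.mul_mem_mul (hJ _ (by omega) (SetLike.coe_mem _)) (Submodule.subset_span hy)

variable [∀ d, FiniteDimensional K (𝒜 d)]

theorem finrank_idealDegree_sup_span_singleton_mul (hN' : N'.IsHomogeneous 𝒜)
    (hN : N.IsHomogeneous 𝒜) (ha : a ∈ 𝒜 d) (e : ℕ) :
    Module.finrank K (idealDegree 𝒜 (N' ⊔ Ideal.span {a} * N) (d + e)) +
        Module.finrank K (idealDegree 𝒜 (N ⊓ N'.colon {a}) e) =
      Module.finrank K (idealDegree 𝒜 N' (d + e)) + Module.finrank K (idealDegree 𝒜 N e) := by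
  have hcolon : idealDegree 𝒜 (N ⊓ N'.colon {a}) e =
      idealDegree 𝒜 N e ⊓ (idealDegree 𝒜 N' (d + e)).comap (LinearMap.mulLeft K a) := by
    ext x
    have (hx : x ∈ 𝒜 e) : a * x ∈ 𝒜 (d + e) := SetLike.GradedMul.mul_mem ha hx
    simp only [Submodule.mem_inf, Submodule.restrictScalars_mem, Submodule.mem_comap,
      Submodule.mem_colon_singleton, smul_eq_mul, LinearMap.mulLeft_apply, mul_comm x]
    tauto
  have (I : Ideal A) (i : ℕ) : FiniteDimensional K (idealDegree 𝒜 I i) :=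
    Submodule.finiteDimensional_of_le inf_le_right
  rw [idealDegree_sup hN' (isHomogeneous_span_singleton_mul hN ha),
    idealDegree_span_singleton_mul hN ha, hcolon]
  exact finrank_sup_map_add_finrank_inf_comap _ _ _

theorem one_sub_X_pow_mul_hilbertSeries_sub (hN' : N'.IsHomogeneous 𝒜) (hN : N.IsHomogeneous 𝒜)
    (ha : a ∈ 𝒜 d) :
    (1 - PowerSeries.X ^ d) * (hilbertSeries 𝒜 N - hilbertSeries 𝒜 N') =
      (hilbertSeries 𝒜 N - hilbertSeries 𝒜 (N' ⊔ Ideal.span {a} * N)) -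
        PowerSeries.X ^ d * (hilbertSeries 𝒜 (N ⊓ N'.colon {a}) - hilbertSeries 𝒜 N') := by
  suffices h : hilbertSeries 𝒜 (N' ⊔ Ideal.span {a} * N) - hilbertSeries 𝒜 N' =
      PowerSeries.X ^ d * (hilbertSeries 𝒜 N - hilbertSeries 𝒜 (N ⊓ N'.colon {a})) by
    linear_combination h
  ext e
  simp only [PowerSeries.coeff_X_pow_mul', map_sub, coeff_hilbertSeries]
  split_ifs with he
  · obtain ⟨e, rfl⟩ := Nat.exists_eq_add_of_le he
    have := finrank_idealDegree_sup_span_singleton_mul hN' hN ha e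
    rw [Nat.add_sub_cancel_left]
    omega
  · rw [idealDegree_sup hN' (isHomogeneous_span_singleton_mul hN ha),
      idealDegree_span_singleton_mul_of_lt N ha (not_le.1 he), sup_bot_eq, sub_self]

theorem prod_one_sub_X_pow_mem_denominatorIdeal [IsNoetherianRing A] {ι : Type*} (s : Finset ι)
    {a : ι → A} {d : ι → ℕ} (ha : ∀ i ∈ s, a i ∈ 𝒜 (d i)) {n : ℕ} {J : Ideal A}
    (hJ : ∀ e ≥ n, 𝒜 e ≤ (J ⊔ Ideal.span (a '' s)).restrictScalars K)
    (hN' : N'.IsHomogeneous 𝒜) (hN : N.IsHomogeneous 𝒜) (hle : N' ≤ N) (hJN : J * N ≤ N') :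
    ∏ i ∈ s, (1 - X ^ d i : ℤ[X]) ∈
      denominatorIdeal (hilbertSeries 𝒜 N - hilbertSeries 𝒜 N') := by
  classical
  -- Multiplication by `a = a i` on `M = N / N'` has the cokernel `N / (N' + a N)` and the kernel
  -- `(N ∩ (N' : a)) / N'`; both are killed by `J + (a)`, and `(1 - t ^ d i) H(M)` is, up to a power
  -- of `t` on the second term, the difference of their Hilbert series.
  induction s using Finset.induction_on generalizing J N N' with
  | empty =>
    simp only [Finset.coe_empty, Set.image_empty, Ideal.span_empty, sup_bot_eq] at hJ
    obtain ⟨m, hm⟩ := exists_idealDegree_le_mul hN hJ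
    refine mem_denominatorIdeal_iff_exists_coeff_eq_zero.2 ⟨m, fun e he => ?_⟩
    have heq : idealDegree 𝒜 N e = idealDegree 𝒜 N' e :=
      le_antisymm (le_inf ((hm e he).trans hJN) inf_le_right) (inf_le_inf_right _ hle)
    rw [Finset.prod_empty, coe_one, one_mul, map_sub, coeff_hilbertSeries, coeff_hilbertSeries, heq,
      sub_self]
  | insert i s hi ih =>
    have hai : a i ∈ 𝒜 (d i) := ha i (Finset.mem_insert_self i s)
    replace ha := fun j hj => ha j (Finset.mem_insert_of_mem hj)
    simp only [Finset.coe_insert, Set.image_insert_eq, Ideal.span_insert, ← sup_assoc] at hJ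
    have hsup := ih ha hJ (hN'.sup (isHomogeneous_span_singleton_mul hN hai)) hN
      (sup_le hle Ideal.mul_le_right) (by
        rw [Ideal.sup_mul]
        exact sup_le_sup_right hJN _)
    have hcolon := ih ha hJ hN' (hN.inf (isHomogeneous_colon_singleton hN' hai))
      (le_inf hle Ideal.le_colon) (by
        rw [Ideal.sup_mul]
        refine sup_le ((Ideal.mul_mono_right inf_le_left).trans hJN) ?_
        refine Ideal.span_singleton_mul_le_iff.2 fun x hx => ?_
        exact mul_comm x (a i) ▸ Submodule.mem_colon_singleton.1 hx.2)
    rw [Finset.prod_insert hi, mul_comm, mul_mem_denominatorIdeal, coe_sub, coe_one, coe_pow,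
      coe_X, one_sub_X_pow_mul_hilbertSeries_sub hN' hN hai]
    refine denominatorIdeal_inf_le_sub ⟨hsup, ?_⟩
    rw [← coe_X, ← coe_pow]
    exact denominatorIdeal_le_mul _ hcolon

end HilbertSerre

section Convergence

variable {𝕜 : Type*} [NormedField 𝕜] {F G : PowerSeries 𝕜} {t s s' : 𝕜}

/-- The power series `F` converges absolutely at `t`, with sum `s`. -/
structure HasAbsSumAt (F : PowerSeries 𝕜) (t s : 𝕜) : Prop where
  summable_norm : Summable fun n => ‖F.coeff n * t ^ n‖
  hasSum : HasSum (fun n => F.coeff n * t ^ n) s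

theorem hasAbsSumAt_coe (p : 𝕜[X]) (t : 𝕜) : HasAbsSumAt (p : PowerSeries 𝕜) t (p.eval t) := by
  have eq_zero_of_notMem : ∀ n ∉ p.support, (p : PowerSeries 𝕜).coeff n * t ^ n = 0 := by
    intro n hn
    rw [coeff_coe, notMem_support_iff.1 hn, zero_mul]
  constructor
  · exact summable_of_ne_finset_zero (s := p.support) fun n hn => by
      rw [eq_zero_of_notMem n hn, norm_zero]
  · rw [eval_eq_sum, Polynomial.sum]
    simpa only [coeff_coe] using hasSum_sum_of_ne_finset_zero eq_zero_of_notMem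

theorem HasAbsSumAt.mul [CompleteSpace 𝕜] (hF : HasAbsSumAt F t s) (hG : HasAbsSumAt G t s') :
    HasAbsSumAt (F * G) t (s * s') := by
  have coeff_mul_mul_pow (n : ℕ) : (F * G).coeff n * t ^ n =
      ∑ p ∈ Finset.HasAntidiagonal.antidiagonal n,
        F.coeff p.1 * t ^ p.1 * (G.coeff p.2 * t ^ p.2) := by
    rw [PowerSeries.coeff_mul, Finset.sum_mul]
    refine Finset.sum_congr rfl fun p hp => ?_
    rw [← Finset.HasAntidiagonal.mem_antidiagonal.1 hp, pow_add]
    ring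
  have hnorm := summable_norm_sum_mul_antidiagonal_of_summable_norm hF.1 hG.1
  have hsum := tsum_mul_tsum_eq_tsum_sum_antidiagonal_of_summable_norm hF.1 hG.1
  simp only [← coeff_mul_mul_pow] at hnorm hsum
  rw [hF.2.tsum_eq, hG.2.tsum_eq] at hsum
  exact ⟨hnorm, hsum ▸ hnorm.of_norm.hasSum⟩

theorem hasAbsSumAt_prod [CompleteSpace 𝕜] {ι : Type*} {F : ι → PowerSeries 𝕜} {σ : ι → 𝕜}
    (S : Finset ι) (h : ∀ i ∈ S, HasAbsSumAt (F i) t (σ i)) :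
    HasAbsSumAt (∏ i ∈ S, F i) t (∏ i ∈ S, σ i) := by
  classical
  induction S using Finset.induction_on with
  | empty => simpa only [Finset.prod_empty, coe_one, eval_one] using hasAbsSumAt_coe 1 t
  | insert i S hi ih =>
    rw [Finset.prod_insert hi, Finset.prod_insert hi]
    exact (h i (Finset.mem_insert_self i S)).mul
      (ih fun j hj => h j (Finset.mem_insert_of_mem hj))

end Convergence

section GeomSeries

/-- The power series `1 + X ^ d + X ^ (2 * d) + ⋯`, the inverse of `1 - X ^ d` for `d ≠ 0`. -/
noncomputable def geomSeries (R : Type*) [CommRing R] (d : ℕ) : PowerSeries R :=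
  PowerSeries.mk fun n => if d ∣ n then 1 else 0

theorem one_sub_X_pow_mul_geomSeries (R : Type*) [CommRing R] {d : ℕ} (hd : d ≠ 0) :
    ((1 - X ^ d : R[X]) : PowerSeries R) * geomSeries R d = 1 := by
  ext n
  rw [coe_sub, coe_one, coe_pow, coe_X, sub_mul, one_mul, map_sub, PowerSeries.coeff_X_pow_mul',
    PowerSeries.coeff_one, geomSeries, PowerSeries.coeff_mk, PowerSeries.coeff_mk]
  rcases eq_or_ne n 0 with rfl | hn
  · simp [hd]
  · rw [if_neg hn]
    by_cases hdn : d ≤ n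
    · have hdvd : d ∣ n - d ↔ d ∣ n := Nat.dvd_sub_iff_left hdn dvd_rfl
      simp only [hdn, hdvd, if_true, sub_self]
    · rw [if_neg hdn, if_neg fun h => hdn (Nat.le_of_dvd (Nat.pos_of_ne_zero hn) h), sub_zero]

theorem coeff_prod_geomSeries (R : Type*) [CommRing R] {ι : Type*} [Fintype ι] [DecidableEq ι]
    (d : ι → ℕ) (n : ℕ) : (∏ i, geomSeries R (d i)).coeff n =
      (((Finset.univ : Finset ι).finsuppAntidiag n).filter fun l => ∀ i, d i ∣ l i).card := by
  rw [PowerSeries.coeff_prod, Finset.card_filter, Nat.cast_sum]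
  refine Finset.sum_congr rfl fun l _ => ?_
  simp only [geomSeries, PowerSeries.coeff_mk]
  rw [Finset.prod_ite_zero, Finset.prod_const_one]
  simp

theorem hasAbsSumAt_geomSeries {𝕜 : Type*} [NormedField 𝕜] [CompleteSpace 𝕜] {t : 𝕜}
    (ht : ‖t‖ < 1) {d : ℕ} (hd : d ≠ 0) : HasAbsSumAt (geomSeries 𝕜 d) t (1 - t ^ d)⁻¹ := by
  have hnorm : Summable fun n => ‖(geomSeries 𝕜 d).coeff n * t ^ n‖ := by
    refine .of_nonneg_of_le (fun _ => norm_nonneg _) (fun n => ?_)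
      (summable_geometric_of_lt_one (norm_nonneg t) ht)
    rw [geomSeries, PowerSeries.coeff_mk, norm_mul, norm_pow]
    refine mul_le_of_le_one_left (pow_nonneg (norm_nonneg t) n) ?_
    split_ifs <;> simp
  have hsum : HasAbsSumAt (geomSeries 𝕜 d) t _ := ⟨hnorm, hnorm.of_norm.hasSum⟩
  have hone := (hasAbsSumAt_coe (1 - X ^ d) t).mul hsum
  rw [one_sub_X_pow_mul_geomSeries 𝕜 hd, ← coe_one, eval_sub, eval_one, eval_pow, eval_X] at hone
  rwa [eq_inv_of_mul_eq_one_right (hone.hasSum.unique (hasAbsSumAt_coe 1 t).hasSum |>.trans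
    eval_one)] at hsum

theorem exists_hasAbsSumAt_of_mem_denominatorIdeal {𝕜 : Type*} [NormedField 𝕜] [CompleteSpace 𝕜]
    {ι : Type*} {S : Finset ι} {d : ι → ℕ} (hd : ∀ i ∈ S, d i ≠ 0) {F : PowerSeries 𝕜}
    (hF : ∏ i ∈ S, (1 - X ^ d i : 𝕜[X]) ∈ denominatorIdeal F) {t : 𝕜} (ht : ‖t‖ < 1) :
    ∃ s, HasAbsSumAt F t s := by
  obtain ⟨Q, hQ⟩ := mem_denominatorIdeal.1 hF
  have hF : F = Q * ∏ i ∈ S, geomSeries 𝕜 (d i) := by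
    rw [← hQ, mul_right_comm, ← coeToPowerSeries.ringHom_apply, map_prod, ← Finset.prod_mul_distrib]
    simp only [coeToPowerSeries.ringHom_apply]
    rw [Finset.prod_eq_one fun i hi => one_sub_X_pow_mul_geomSeries 𝕜 (hd i hi), one_mul]
  exact ⟨_, hF ▸ (hasAbsSumAt_coe Q t).mul
    (hasAbsSumAt_prod S fun i hi => hasAbsSumAt_geomSeries ht (hd i hi))⟩

end GeomSeries

section PoleOrder

open Filter Asymptotics Topology

theorem isTheta_pow_rootMultiplicity {𝕜 : Type*} [NormedField 𝕜] {p : 𝕜[X]} (hp : p ≠ 0) (a : 𝕜) :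
    (fun x => p.eval x) =Θ[𝓝 a] fun x => (x - a) ^ p.rootMultiplicity a := by
  obtain ⟨q, hpq, hq⟩ := exists_eq_pow_rootMultiplicity_mul_and_not_dvd p hp a
  rw [dvd_iff_isRoot, IsRoot.def] at hq
  have hq_theta : (fun x => q.eval x) =Θ[𝓝 a] fun _ => (1 : 𝕜) :=
    ((isEquivalent_const_iff_tendsto hq).2 (q.continuous.tendsto a)).isTheta.trans
      (isTheta_const_const hq one_ne_zero)
  have heval : (fun x => p.eval x) = fun x => (x - a) ^ p.rootMultiplicity a * q.eval x := by
    funext x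
    conv_lhs => rw [hpq]
    rw [eval_mul, eval_pow, eval_sub, eval_X, eval_C]
  rw [heval]
  simpa only [mul_one] using
    (isTheta_refl (fun x => (x - a) ^ p.rootMultiplicity a) (𝓝 a)).mul hq_theta

theorem rootMultiplicity_le_of_isBigO {𝕜 : Type*} [NormedField 𝕜] {p q : 𝕜[X]} (hp : p ≠ 0)
    (hq : q ≠ 0) {a : 𝕜} {l : Filter 𝕜} [l.NeBot] (hl : l ≤ 𝓝[≠] a)
    (h : (fun x => p.eval x) =O[l] fun x => q.eval x) :
    q.rootMultiplicity a ≤ p.rootMultiplicity a := by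
  have hl' : l ≤ 𝓝 a := hl.trans nhdsWithin_le_nhds
  by_contra! hlt
  have hpow : (fun x => (x - a) ^ p.rootMultiplicity a) =O[l]
      fun x => (x - a) ^ q.rootMultiplicity a :=
    ((isTheta_pow_rootMultiplicity hp a).2.mono hl').trans
      (h.trans ((isTheta_pow_rootMultiplicity hq a).1.mono hl'))
  have hlittle : (fun x => (x - a) ^ q.rootMultiplicity a) =o[l]
      fun x => (x - a) ^ p.rootMultiplicity a := by
    simpa only [← norm_pow, isLittleO_norm_norm] using (isLittleO_pow_sub_pow_sub a hlt).mono hl'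
  refine isLittleO_irrefl (Eventually.frequently ?_) (hpow.trans_isLittleO hlittle)
  filter_upwards [hl self_mem_nhdsWithin] with x hx using pow_ne_zero _ (sub_ne_zero.2 hx)

theorem one_le_mul_pow_mul_of_coeff_prod_geomSeries_le {ι : Type*} [Fintype ι] {e : ι → ℕ}
    (he : ∀ i, e i ≠ 0) {F : PowerSeries ℝ}
    (hF : ∀ n, (∏ i, geomSeries ℝ (e i)).coeff n ≤ F.coeff n) {t s : ℝ} (ht : t ∈ Set.Ioo (0 : ℝ) 1)
    (hs : HasAbsSumAt F t s) : 1 ≤ (∏ i, (e i : ℝ)) * (1 - t) ^ Fintype.card ι * s := by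
  have norm_lt_one : ‖t‖ < 1 := by rw [Real.norm_of_nonneg ht.1.le]; exact ht.2
  have one_sub_pow_pos (i : ι) : 0 < 1 - t ^ e i :=
    sub_pos.2 (pow_lt_one₀ ht.1.le ht.2 (he i))
  have one_sub_pow_le (i : ι) : 1 - t ^ e i ≤ e i * (1 - t) := by
    linarith [one_add_mul_sub_le_pow (show -1 ≤ t by linarith [ht.1]) (e i)]
  have hle : ∏ i, (1 - t ^ e i)⁻¹ ≤ s :=
    hasSum_le (fun n => mul_le_mul_of_nonneg_right (hF n) (pow_nonneg ht.1.le n))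
      (hasAbsSumAt_prod Finset.univ fun i _ => hasAbsSumAt_geomSeries norm_lt_one (he i)).hasSum
      hs.hasSum
  have prod_pos : 0 < ∏ i, (1 - t ^ e i) := Finset.prod_pos fun i _ => one_sub_pow_pos i
  rw [Finset.prod_inv_distrib] at hle
  calc 1 = (∏ i, (1 - t ^ e i)) * (∏ i, (1 - t ^ e i))⁻¹ := (mul_inv_cancel₀ prod_pos.ne').symm
    _ ≤ (∏ i, (e i * (1 - t))) * s :=
      mul_le_mul (Finset.prod_le_prod (fun i _ => (one_sub_pow_pos i).le) fun i _ =>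
        one_sub_pow_le i) hle (inv_nonneg.2 prod_pos.le)
        (Finset.prod_nonneg fun i _ => (one_sub_pow_pos i).le.trans (one_sub_pow_le i))
    _ = (∏ i, (e i : ℝ)) * (1 - t) ^ Fintype.card ι * s := by
      rw [Finset.prod_mul_distrib, Finset.prod_const, Finset.card_univ]

theorem card_add_rootMultiplicity_one_le {ι : Type*} [Fintype ι] {e : ι → ℕ} (he : ∀ i, e i ≠ 0)
    {B P : ℝ[X]} {F : PowerSeries ℝ} (hB : B ≠ 0) (hP : P ≠ 0) (hBF : (B : PowerSeries ℝ) * F = P)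
    (hsum : ∀ t ∈ Set.Ioo (0 : ℝ) 1, ∃ s, HasAbsSumAt F t s)
    (hF : ∀ n, (∏ i, geomSeries ℝ (e i)).coeff n ≤ F.coeff n) :
    Fintype.card ι + P.rootMultiplicity 1 ≤ B.rootMultiplicity 1 := by
  have hX : ((X - C 1) ^ Fintype.card ι : ℝ[X]) ≠ 0 := pow_ne_zero _ (X_sub_C_ne_zero 1)
  rw [← rootMultiplicity_X_sub_C_pow (1 : ℝ) (Fintype.card ι),
    ← rootMultiplicity_mul (mul_ne_zero hX hP)]
  refine rootMultiplicity_le_of_isBigO (l := 𝓝[<] 1) hB (mul_ne_zero hX hP)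
    (nhdsWithin_mono _ fun t ht => ne_of_lt ht) (.of_bound (∏ i, (e i : ℝ)) ?_)
  filter_upwards [Ioo_mem_nhdsLT zero_lt_one] with t ht
  obtain ⟨s, hs⟩ := hsum t ht
  have hBs : B.eval t * s = P.eval t :=
    ((hasAbsSumAt_coe B t).mul hs).hasSum.unique (hBF ▸ (hasAbsSumAt_coe P t).hasSum)
  have one_le := one_le_mul_pow_mul_of_coeff_prod_geomSeries_le he hF ht hs
  have norm_sub : ‖t - 1‖ = 1 - t := by
    rw [norm_sub_rev, Real.norm_of_nonneg (sub_nonneg.2 ht.2.le)]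
  simp only [eval_mul, eval_pow, eval_sub, eval_X, eval_C, norm_mul, norm_pow, norm_sub, ← hBs]
  calc ‖B.eval t‖ ≤ ‖B.eval t‖ * ((∏ i, (e i : ℝ)) * (1 - t) ^ Fintype.card ι * s) :=
      le_mul_of_one_le_right (norm_nonneg _) one_le
    _ ≤ ‖B.eval t‖ * ((∏ i, (e i : ℝ)) * (1 - t) ^ Fintype.card ι * ‖s‖) := by
      have := sub_nonneg.2 ht.2.le
      gcongr
      exact Real.le_norm_self s
    _ = _ := by ring

theorem rootMultiplicity_add_rootMultiplicity_one {K : Type*} [Field K] {w : K} (hw : w ≠ 0)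
    {B P : K[X]} {F : PowerSeries K} (hB : B ≠ 0) (hP : P ≠ 0) (hBF : (B : PowerSeries K) * F = P)
    (hF : ∀ d, w ^ d ≠ 1 → F.coeff d = 0) :
    B.rootMultiplicity w + P.rootMultiplicity 1 = B.rootMultiplicity 1 + P.rootMultiplicity w := by
  -- `F(w t) = F(t)`, hence `B(w t) P(t) = B(t) P(w t)`; compare the orders of vanishing at `t = 1`.
  have rescale_F : PowerSeries.rescale w F = F := by
    ext d
    rw [PowerSeries.coeff_rescale]
    by_cases hd : w ^ d = 1
    · rw [hd, one_mul]
    · rw [hF d hd, mul_zero]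
  have rescale_coe (p : K[X]) : PowerSeries.rescale w (p : PowerSeries K) =
      (p.comp (C w * X + C 0) : K[X]) := by
    ext d
    rw [PowerSeries.coeff_rescale, coeff_coe, coeff_coe, map_zero, add_zero, comp_C_mul_X_coeff,
      mul_comm]
  have rootMultiplicity_comp (p : K[X]) :
      (p.comp (C w * X + C 0)).rootMultiplicity 1 = p.rootMultiplicity w := by
    rw [rootMultiplicity_comp_C_mul_X_add_C _ _ _ _ hw.isUnit, mul_one, add_zero]
  have comp_ne_zero {p : K[X]} (hp : p ≠ 0) : p.comp (C w * X + C 0) ≠ 0 := by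
    rwa [Ne, ← coe_eq_zero_iff, ← rescale_coe,
      map_eq_zero_iff _ (PowerSeries.rescale_injective hw), coe_eq_zero_iff]
  have comp_mul_eq : B.comp (C w * X + C 0) * P = B * P.comp (C w * X + C 0) := by
    apply coe_injective
    rw [coe_mul, coe_mul, ← rescale_coe, ← rescale_coe, ← hBF, map_mul, rescale_F]
    ring
  have := congrArg (rootMultiplicity 1) comp_mul_eq
  rwa [rootMultiplicity_mul (mul_ne_zero (comp_ne_zero hB) hP),
    rootMultiplicity_mul (mul_ne_zero hB (comp_ne_zero hP)), rootMultiplicity_comp,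
    rootMultiplicity_comp] at this

theorem rootMultiplicity_one_map {R S : Type*} [CommRing R] [CommRing S] {f : R →+* S}
    (hf : Function.Injective f) (p : R[X]) :
    (p.map f).rootMultiplicity 1 = p.rootMultiplicity 1 := by
  rw [eq_rootMultiplicity_map hf, map_one]

theorem coe_map_mul_map {R S : Type*} [CommRing R] [CommRing S] (f : R →+* S) {B P : R[X]}
    {F : PowerSeries R} (h : (B : PowerSeries R) * F = P) :
    ((B.map f : S[X]) : PowerSeries S) * F.map f = (P.map f : S[X]) := by
  rw [polynomial_map_coe, polynomial_map_coe, ← map_mul, h]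

theorem card_le_rootMultiplicity_of_mem_denominatorIdeal {K ι κ : Type*} [Field K] [CharZero K]
    [Fintype ι] {w : K} (hw : w ≠ 0) {e : ι → ℕ} (he : ∀ i, e i ≠ 0) {S : Finset κ} {d : κ → ℕ}
    (hd : ∀ i ∈ S, d i ≠ 0) {F : PowerSeries ℤ}
    (hdF : ∏ i ∈ S, (1 - X ^ d i : ℤ[X]) ∈ denominatorIdeal F)
    (hwF : ∀ n, w ^ n ≠ 1 → F.coeff n = 0)
    (heF : ∀ n, (∏ i, geomSeries ℤ (e i)).coeff n ≤ F.coeff n)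
    {B : ℤ[X]} (hB : B ≠ 0) (hBF : B ∈ denominatorIdeal F) :
    Fintype.card ι ≤ (B.map (Int.castRingHom K)).rootMultiplicity w := by
  classical
  obtain ⟨P, hP⟩ := mem_denominatorIdeal.1 hBF
  have hF0 : F ≠ 0 := by
    rintro rfl
    have := heF 0
    simp [PowerSeries.coeff_zero_eq_constantCoeff, geomSeries] at this
  have hP0 : P ≠ 0 := by
    rintro rfl
    rw [coe_zero, mul_eq_zero, coe_eq_zero_iff] at hP
    exact hP.elim hB hF0
  have hℝ : Function.Injective (Int.castRingHom ℝ) := Int.cast_injective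
  have hK : Function.Injective (Int.castRingHom K) := Int.cast_injective
  have hdFℝ : ∏ i ∈ S, (1 - X ^ d i : ℝ[X]) ∈ denominatorIdeal (F.map (Int.castRingHom ℝ)) := by
    simpa only [Polynomial.map_prod, Polynomial.map_sub, Polynomial.map_one, Polynomial.map_pow,
      map_X] using (map_mem_denominatorIdeal hℝ).2 hdF
  have heFℝ (n : ℕ) :
      (∏ i, geomSeries ℝ (e i)).coeff n ≤ (F.map (Int.castRingHom ℝ)).coeff n := by
    have := heF n
    rw [coeff_prod_geomSeries] at this ⊢
    rw [PowerSeries.coeff_map, eq_intCast]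
    exact_mod_cast this
  have at_one := card_add_rootMultiplicity_one_le he ((Polynomial.map_ne_zero_iff hℝ).2 hB)
    ((Polynomial.map_ne_zero_iff hℝ).2 hP0) (coe_map_mul_map _ hP)
    (fun t ht => exists_hasAbsSumAt_of_mem_denominatorIdeal hd hdFℝ
      ((Real.norm_of_nonneg ht.1.le).trans_lt ht.2)) heFℝ
  have at_w := rootMultiplicity_add_rootMultiplicity_one hw ((Polynomial.map_ne_zero_iff hK).2 hB)
    ((Polynomial.map_ne_zero_iff hK).2 hP0) (coe_map_mul_map _ hP)
    (fun n hn => by rw [PowerSeries.coeff_map, hwF n hn, map_zero])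
  rw [rootMultiplicity_one_map hℝ, rootMultiplicity_one_map hℝ] at at_one
  rw [rootMultiplicity_one_map hK, rootMultiplicity_one_map hK] at at_w
  omega

end PoleOrder

section CoordinateRing

variable {K V W Y : Type*} [Field K] [AddCommGroup V] [Module K V] [AddCommGroup W] [Module K W]
  [AddCommGroup Y] [Module K Y]

theorem linearForm_mem_coordinateRingDegree (m : Module.Dual K Y) :
    linearForm K Y m ∈ coordinateRingDegree K Y 1 := by
  rw [coordinateRingDegree, pow_one]
  exact LinearMap.mem_range_self _ m

/-- Evaluation of polynomial functions at a point. -/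
noncomputable def evalAt (y : Y) : CoordinateRing K Y →ₐ[K] K :=
  coordinateRingLift (Module.Dual.eval K Y y)

theorem evalAt_linearForm (y : Y) (m : Module.Dual K Y) : evalAt y (linearForm K Y m) = m y := by
  rw [evalAt, coordinateRingLift_linearForm, Module.Dual.eval_apply]

theorem ker_evalAt_injective : Function.Injective fun y : Y => RingHom.ker (evalAt (K := K) y) := by
  intro y z h
  refine sub_eq_zero.1 ((Module.forall_dual_apply_eq_zero_iff K (y - z)).1 fun m => ?_)
  have hm : linearForm K Y m - algebraMap K _ (m z) ∈ RingHom.ker (evalAt (K := K) z) := by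
    rw [RingHom.mem_ker, map_sub, evalAt_linearForm, AlgHom.commutes, Algebra.algebraMap_self_apply,
      sub_self]
  rw [← show RingHom.ker (evalAt (K := K) y) = RingHom.ker (evalAt (K := K) z) from h,
    RingHom.mem_ker, map_sub, evalAt_linearForm, AlgHom.commutes,
    Algebra.algebraMap_self_apply] at hm
  rw [map_sub, hm]

/-- The pullback `f ↦ f ∘ φ` of polynomial functions along a linear map `φ`. -/
noncomputable def coordinateRingMap (φ : V →ₗ[K] Y) : CoordinateRing K Y →ₐ[K] CoordinateRing K V :=
  coordinateRingLift (linearForm K V ∘ₗ φ.dualMap)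

theorem coordinateRingMap_linearForm (φ : V →ₗ[K] Y) (m : Module.Dual K Y) :
    coordinateRingMap φ (linearForm K Y m) = linearForm K V (m ∘ₗ φ) :=
  coordinateRingLift_linearForm _ m

theorem coordinateRingMap_comp (φ : V →ₗ[K] W) (ψ : W →ₗ[K] Y) :
    coordinateRingMap (ψ ∘ₗ φ) = (coordinateRingMap φ).comp (coordinateRingMap ψ) := by
  refine coordinateRing_algHom_ext fun m => ?_
  rw [AlgHom.comp_apply]
  simp only [coordinateRingMap_linearForm, LinearMap.comp_assoc]

theorem coordinateRingMap_id :
    coordinateRingMap LinearMap.id = AlgHom.id K (CoordinateRing K Y) := by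
  refine coordinateRing_algHom_ext fun m => ?_
  rw [coordinateRingMap_linearForm, LinearMap.comp_id, AlgHom.id_apply]

theorem evalAt_coordinateRingMap (φ : V →ₗ[K] Y) (v : V) (f : CoordinateRing K Y) :
    evalAt v (coordinateRingMap φ f) = evalAt (φ v) f := by
  have : (evalAt v).comp (coordinateRingMap φ) = evalAt (φ v) := by
    refine coordinateRing_algHom_ext fun m => ?_
    rw [AlgHom.comp_apply, coordinateRingMap_linearForm, evalAt_linearForm, evalAt_linearForm,
      LinearMap.comp_apply]
  rw [← this, AlgHom.comp_apply]

theorem coordinateRingMap_mem (φ : V →ₗ[K] Y) {d : ℕ} {f : CoordinateRing K Y}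
    (hf : f ∈ coordinateRingDegree K Y d) : coordinateRingMap φ f ∈ coordinateRingDegree K V d := by
  have : (coordinateRingDegree K Y d).map (coordinateRingMap φ).toLinearMap ≤
      coordinateRingDegree K V d := by
    rw [coordinateRingDegree, coordinateRingDegree, Submodule.map_pow]
    refine pow_le_pow_left' ?_ d
    rintro _ ⟨_, ⟨m, rfl⟩, rfl⟩
    exact ⟨m ∘ₗ φ, (coordinateRingMap_linearForm φ m).symm⟩
  exact this ⟨f, hf, rfl⟩

theorem coordinateRingMap_smul_id (w : K) {d : ℕ} {f : CoordinateRing K Y}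
    (hf : f ∈ coordinateRingDegree K Y d) :
    coordinateRingMap (w • LinearMap.id) f = w ^ d • f := by
  unfold coordinateRingDegree at hf
  induction hf using Submodule.pow_induction_on_left' with
  | algebraMap r => rw [AlgHom.commutes, pow_zero, one_smul]
  | add f f' i _ _ h h' => rw [map_add, h, h', smul_add]
  | mem_mul m hm i f _ h =>
    obtain ⟨m, rfl⟩ := hm
    rw [map_mul, h, coordinateRingMap_linearForm, LinearMap.comp_smul, LinearMap.comp_id, map_smul,
      smul_mul_smul_comm, Nat.succ_eq_add_one, pow_succ']

theorem evalAt_smul (w : K) (y : Y) {d : ℕ} {f : CoordinateRing K Y}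
    (hf : f ∈ coordinateRingDegree K Y d) : evalAt (w • y) f = w ^ d * evalAt y f := by
  have := evalAt_coordinateRingMap (w • LinearMap.id) y f
  rwa [coordinateRingMap_smul_id w hf, map_smul, smul_eq_mul, eq_comm] at this

theorem coordinateRingMap_subtype_surjective (V : Submodule K Y) :
    Function.Surjective (coordinateRingMap (K := K) V.subtype) := by
  obtain ⟨π, hπ⟩ := V.subtype.exists_leftInverse_of_injective V.ker_subtype
  intro f
  refine ⟨coordinateRingMap π f, ?_⟩
  rw [← AlgHom.comp_apply, ← coordinateRingMap_comp, hπ, coordinateRingMap_id, AlgHom.id_apply]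

/-- A basis of `Y` identifies `K[Y]` with a polynomial ring. -/
noncomputable def coordinateRingEquiv {ι : Type*} [Finite ι] [DecidableEq ι]
    (b : Module.Basis ι K Y) : CoordinateRing K Y ≃ₐ[K] MvPolynomial ι K :=
  SymmetricAlgebra.equivMvPolynomial b.dualBasis

theorem coordinateRingEquiv_symm_X {ι : Type*} [Finite ι] [DecidableEq ι]
    (b : Module.Basis ι K Y) (i : ι) :
    (coordinateRingEquiv b).symm (MvPolynomial.X i) = linearForm K Y (b.dualBasis i) :=
  SymmetricAlgebra.equivMvPolynomial_symm_X b.dualBasis i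

theorem evalAt_coordinateRingEquiv_symm {ι : Type*} [Finite ι] [DecidableEq ι]
    (b : Module.Basis ι K Y) (y : Y) (p : MvPolynomial ι K) :
    evalAt y ((coordinateRingEquiv b).symm p) = MvPolynomial.aeval (b.repr y) p := by
  have : (evalAt y).comp ((coordinateRingEquiv b).symm : MvPolynomial ι K →ₐ[K] _) =
      MvPolynomial.aeval (b.repr y) := by
    refine MvPolynomial.algHom_ext fun i => ?_
    rw [AlgHom.comp_apply, AlgEquiv.coe_toAlgHom, coordinateRingEquiv_symm_X, evalAt_linearForm,
      MvPolynomial.aeval_X, Module.Basis.dualBasis_apply]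
  exact DFunLike.congr_fun this p

theorem coordinateRingDegree_mem_span_pow {d : ℕ} {f : CoordinateRing K Y}
    (hf : f ∈ coordinateRingDegree K Y d) :
    f ∈ Ideal.span (Set.range (linearForm K Y)) ^ d := by
  unfold coordinateRingDegree at hf
  induction hf using Submodule.pow_induction_on_left' with
  | algebraMap r => rw [pow_zero, Ideal.one_eq_top]; trivial
  | add f f' i _ _ h h' => exact add_mem h h'
  | mem_mul m hm i f _ h =>
    obtain ⟨m, rfl⟩ := hm
    rw [Nat.succ_eq_add_one, pow_succ']
    exact Ideal.mul_mem_mul (Ideal.subset_span ⟨m, rfl⟩) h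

variable [FiniteDimensional K Y]

instance coordinateRing_isNoetherianRing : IsNoetherianRing (CoordinateRing K Y) :=
  isNoetherianRing_of_ringEquiv _ (coordinateRingEquiv (Module.finBasis K Y)).symm.toRingEquiv

instance coordinateRing_isDomain : IsDomain (CoordinateRing K Y) :=
  (coordinateRingEquiv (Module.finBasis K Y)).toMulEquiv.isDomain _

theorem trdeg_coordinateRing : Algebra.trdeg K (CoordinateRing K Y) = Module.finrank K Y := by
  have := (coordinateRingEquiv (Module.finBasis K Y)).lift_trdeg_eq
  rwa [MvPolynomial.trdeg_of_isDomain, Cardinal.mk_fin, Cardinal.lift_natCast,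
    Cardinal.lift_natCast, Cardinal.lift_eq_nat_iff] at this

instance coordinateRingDegree_finiteDimensional (d : ℕ) :
    FiniteDimensional K (coordinateRingDegree K Y d) := by
  refine Module.Finite.iff_fg.2 (Submodule.FG.pow (Module.Finite.iff_fg.1 ?_) d)
  infer_instance

theorem mem_radical_of_evalAt_eq_zero [IsAlgClosed K] {J : Ideal (CoordinateRing K Y)}
    {f : CoordinateRing K Y}
    (h : ∀ y : Y, (∀ a ∈ J, evalAt y a = 0) → evalAt y f = 0) : f ∈ J.radical := by
  let b := Module.finBasis K Y
  let e := coordinateRingEquiv b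
  have evalAt_eq (x : Fin (Module.finrank K Y) → K) (a : CoordinateRing K Y) :
      evalAt (b.equivFun.symm x) a = MvPolynomial.aeval x (e a) := by
    rw [← e.symm_apply_apply a, evalAt_coordinateRingEquiv_symm, e.apply_symm_apply,
      ← b.equivFun_apply, LinearEquiv.apply_symm_apply]
  have hf : e f ∈ (J.comap (e.symm : MvPolynomial _ K →+* CoordinateRing K Y)).radical := by
    rw [← MvPolynomial.vanishingIdeal_zeroLocus_eq_radical (K := K)]
    intro x hx
    rw [← evalAt_eq]
    refine h _ fun a ha => ?_
    rw [evalAt_eq]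
    exact hx (e a) (by rwa [Ideal.mem_comap, RingHom.coe_coe, e.symm_apply_apply])
  rw [← Ideal.comap_radical, Ideal.mem_comap, RingHom.coe_coe, e.symm_apply_apply] at hf
  exact hf

theorem exists_coordinateRingDegree_le [IsAlgClosed K] {J : Ideal (CoordinateRing K Y)}
    (h : ∀ y : Y, (∀ a ∈ J, evalAt y a = 0) → y = 0) :
    ∃ n, ∀ d ≥ n, ∀ f ∈ coordinateRingDegree K Y d, f ∈ J := by
  have hr : Ideal.span (Set.range (linearForm K Y)) ≤ J.radical := by
    rw [Ideal.span_le]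
    rintro _ ⟨m, rfl⟩
    refine mem_radical_of_evalAt_eq_zero fun y hy => ?_
    rw [h y hy, evalAt_linearForm, map_zero]
  obtain ⟨n, hn⟩ := Ideal.exists_pow_le_of_le_radical_of_fg hr (IsNoetherian.noetherian _)
  exact ⟨n, fun d hd f hf => hn (Ideal.pow_le_pow_right hd (coordinateRingDegree_mem_span_pow hf))⟩

end CoordinateRing

section Invariants

theorem comap_map_eq_of_retraction {R S : Type*} [CommRing R] [CommRing S] [Algebra R S]
    {π : S →ₗ[R] R} (hπ : ∀ r, π (algebraMap R S r) = r) (I : Ideal R) :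
    (I.map (algebraMap R S)).comap (algebraMap R S) = I := by
  refine le_antisymm (fun r hr => ?_) Ideal.le_comap_map
  have hr' : algebraMap R S r ∈ I • (⊤ : Submodule R S) := by
    rw [Ideal.smul_top_eq_map]
    exact hr
  have hmap := Submodule.mem_map_of_mem (f := π) hr'
  rw [hπ, Submodule.map_smul''] at hmap
  exact Ideal.mul_le_left hmap

theorem isNoetherianRing_of_retraction {R S : Type*} [CommRing R] [CommRing S] [Algebra R S]
    [IsNoetherianRing S] {π : S →ₗ[R] R} (hπ : ∀ r, π (algebraMap R S r) = r) :
    IsNoetherianRing R := by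
  have hmap : StrictMono (Ideal.map (algebraMap R S)) :=
    Monotone.strictMono_of_injective (fun _ _ => Ideal.map_mono)
      (Function.LeftInverse.injective (comap_map_eq_of_retraction hπ))
  have : WellFoundedGT (Ideal S) := isNoetherian_iff'.1 inferInstance
  exact isNoetherian_iff'.2 hmap.wellFoundedGT

theorem exists_dual_forall_eq_bot_of_le_ker {K Y : Type*} [Field K] [Infinite K] [AddCommGroup Y]
    [Module K Y] {𝒲 : Set (Submodule K Y)} (h𝒲 : 𝒲.Finite) :
    ∃ l : Module.Dual K Y, ∀ W ∈ 𝒲, W ≤ LinearMap.ker l → W = ⊥ := by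
  have : Finite {W // W ∈ 𝒲 ∧ W ≠ ⊥} := (h𝒲.subset fun W h => h.1 : {W | W ∈ 𝒲 ∧ W ≠ ⊥}.Finite)
  choose w hwW hw using fun W : {W // W ∈ 𝒲 ∧ W ≠ ⊥} =>
    Submodule.exists_mem_ne_zero_of_ne_bot W.2.2
  obtain ⟨l, hl⟩ := Module.exists_dual_forall_apply_ne_zero (K := K) w hw
  exact ⟨l, fun W hW hle => by_contra fun h => hl ⟨W, hW, h⟩ (hle (hwW ⟨W, hW, h⟩))⟩

variable {K G Y : Type*} [Field K] [Group G] [AddCommGroup Y] [Module K Y]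
  (ρ : Representation K G Y)

theorem coordinateRingAct_eq (g : G) : coordinateRingAct ρ g = coordinateRingMap (ρ g⁻¹) :=
  rfl

theorem coordinateRingAct_mul (g h : G) :
    coordinateRingAct ρ (g * h) = (coordinateRingAct ρ g).comp (coordinateRingAct ρ h) := by
  rw [coordinateRingAct_eq, mul_inv_rev, map_mul, Module.End.mul_eq_comp, coordinateRingMap_comp]
  rfl

theorem evalAt_coordinateRingAct (g : G) (y : Y) (f : CoordinateRing K Y) :
    evalAt y (coordinateRingAct ρ g f) = evalAt (ρ g⁻¹ y) f :=
  evalAt_coordinateRingMap _ y f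

theorem coordinateRingAct_smul (g : G) (a : invariantRing ρ) (f : CoordinateRing K Y) :
    coordinateRingAct ρ g (a • f) = a • coordinateRingAct ρ g f := by
  rw [Subalgebra.smul_def, smul_eq_mul, map_mul, mem_invariantRing.1 a.2]
  rfl

/-- `coordinateRingAct` as an action of `G` by ring automorphisms. It depends on `ρ`, and is
therefore not an instance. -/
@[reducible] noncomputable def coordinateRingAction : MulSemiringAction G (CoordinateRing K Y) where
  smul g := coordinateRingAct ρ g
  one_smul f := by
    change coordinateRingAct ρ 1 f = f
    rw [coordinateRingAct_eq, inv_one, map_one, Module.End.one_eq_id, coordinateRingMap_id,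
      AlgHom.id_apply]
  mul_smul g h := DFunLike.congr_fun (coordinateRingAct_mul ρ g h)
  smul_zero g := map_zero (coordinateRingAct ρ g)
  smul_add g := map_add (coordinateRingAct ρ g)
  smul_one g := map_one (coordinateRingAct ρ g)
  smul_mul g := map_mul (coordinateRingAct ρ g)

theorem isInvariant_invariantRing :
    letI := coordinateRingAction ρ
    Algebra.IsInvariant (invariantRing ρ) (CoordinateRing K Y) G :=
  letI := coordinateRingAction ρ
  ⟨fun f hf => ⟨⟨f, mem_invariantRing.2 hf⟩, rfl⟩⟩

theorem smulCommClass_invariantRing :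
    letI := coordinateRingAction ρ
    SMulCommClass G (invariantRing ρ) (CoordinateRing K Y) :=
  letI := coordinateRingAction ρ
  ⟨coordinateRingAct_smul ρ⟩

theorem isIntegral_invariantRing [Finite G] :
    Algebra.IsIntegral (invariantRing ρ) (CoordinateRing K Y) :=
  letI := coordinateRingAction ρ
  haveI := isInvariant_invariantRing ρ
  Algebra.IsInvariant.isIntegral (invariantRing ρ) (CoordinateRing K Y) G

theorem exists_apply_eq_of_evalAt_eq [Finite G] {y z : Y}
    (h : ∀ f : invariantRing ρ, evalAt y (f : CoordinateRing K Y) = evalAt z f.1) :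
    ∃ g, ρ g y = z := by
  let := coordinateRingAction ρ
  have := isInvariant_invariantRing ρ
  have := smulCommClass_invariantRing ρ
  have hunder : (RingHom.ker (evalAt (K := K) y)).under (invariantRing ρ) =
      (RingHom.ker (evalAt (K := K) z)).under (invariantRing ρ) := by
    ext f
    exact Eq.congr_left (h f)
  obtain ⟨g, hg⟩ := Algebra.IsInvariant.exists_smul_of_under_eq (invariantRing ρ)
    (CoordinateRing K Y) G _ _
    (hP := RingHom.ker_isPrime _) (hQ := RingHom.ker_isPrime _) hunder
  refine ⟨g, ker_evalAt_injective (K := K) ?_⟩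
  ext f
  change f ∈ RingHom.ker (evalAt (K := K) (ρ g y)) ↔ f ∈ RingHom.ker (evalAt (K := K) z)
  rw [hg, Ideal.mem_pointwise_smul_iff_inv_smul_mem, RingHom.mem_ker, RingHom.mem_ker]
  change _ ↔ evalAt y (coordinateRingAct ρ g⁻¹ f) = 0
  rw [evalAt_coordinateRingAct, inv_inv]

theorem exists_apply_eq_smul_of_evalAt_eq_zero [Finite G] {w : K} {y : Y}
    (h : ∀ d, w ^ d ≠ 1 → ∀ a ∈ invariantRingDegree ρ d, evalAt y (a : CoordinateRing K Y) = 0) :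
    ∃ g, ρ g y = w • y := by
  refine exists_apply_eq_of_evalAt_eq ρ fun f => ?_
  induction f using DirectSum.Decomposition.inductionOn (invariantRingDegree ρ) with
  | zero => simp only [ZeroMemClass.coe_zero, map_zero]
  | add f f' hf hf' => simp only [Subalgebra.coe_add, map_add, hf, hf']
  | @homogeneous d f =>
    rw [evalAt_smul w y (show f.1.1 ∈ coordinateRingDegree K Y d from f.2)]
    by_cases hd : w ^ d = 1
    · rw [hd, one_mul]
    · rw [h d hd f f.2, mul_zero]

section Norm

variable [Fintype G]

/-- The product of all the translates of a function. -/
noncomputable def invariantNorm (f : CoordinateRing K Y) : invariantRing ρ :=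
  ⟨∏ g : G, coordinateRingAct ρ g f,
    letI := coordinateRingAction ρ
    mem_invariantRing.2 (Finset.smul_prod_perm f)⟩

theorem evalAt_invariantNorm (f : CoordinateRing K Y) (y : Y) :
    evalAt y (invariantNorm ρ f).1 = ∏ g : G, evalAt (ρ g⁻¹ y) f := by
  simp only [invariantNorm, map_prod, evalAt_coordinateRingAct]

theorem invariantNorm_linearForm_mem (l : Module.Dual K Y) :
    invariantNorm ρ (linearForm K Y l) ∈ invariantRingDegree ρ (Fintype.card G) := by
  have := SetLike.prod_mem_graded (F := Finset.univ) (coordinateRingDegree K Y) (fun _ : G => 1)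
    (fun g => coordinateRingAct ρ g (linearForm K Y l))
    fun g _ => coordinateRingAct_mem ρ g (linearForm_mem_coordinateRingDegree l)
  rwa [Finset.sum_const, smul_eq_mul, mul_one, Finset.card_univ] at this

end Norm

theorem exists_invariants_separating [Infinite K] [Finite G] [FiniteDimensional K Y] {m : ℕ}
    {𝒲 : Set (Submodule K Y)} (h𝒲 : 𝒲.Finite) (hm : ∀ W ∈ 𝒲, Module.finrank K W ≤ m) :
    ∃ θ : Fin m → invariantRing ρ, (∀ j, θ j ∈ invariantRingDegree ρ (Nat.card G)) ∧
      ∀ W ∈ 𝒲, ∀ y ∈ W, (∀ j, evalAt y (θ j).1 = 0) → y = 0 := by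
  have := Fintype.ofFinite G
  -- The zero set of the norm of a linear form `l` is the union of the hyperplanes `ker (l ∘ ρ g)`,
  -- which for a generic `l` meet every nonzero `W ∈ 𝒲` in a proper subspace.
  induction m generalizing 𝒲 with
  | zero =>
    refine ⟨Fin.elim0, fun j => j.elim0, fun W hW y hy _ => ?_⟩
    rwa [Submodule.finrank_eq_zero.1 (Nat.le_zero.1 (hm W hW)), Submodule.mem_bot] at hy
  | succ m ih =>
    obtain ⟨l, hl⟩ := exists_dual_forall_eq_bot_of_le_ker
      (h𝒲.image2 (fun W g => W.map (ρ g)) Set.finite_univ)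
    have finrank_le (W) (hW : W ∈ 𝒲) (g : G) :
        Module.finrank K ↥(W ⊓ LinearMap.ker (l ∘ₗ ρ g)) ≤ m := by
      by_cases hle : W ≤ LinearMap.ker (l ∘ₗ ρ g)
      · have hmap := hl _ ⟨W, hW, g, trivial, rfl⟩ (Submodule.map_le_iff_le_comap.2 hle)
        have hbot : W = ⊥ := Submodule.map_injective_of_injective (ρ.apply_bijective g).1
          (hmap.trans (Submodule.map_bot _).symm)
        rw [hbot, bot_inf_eq, finrank_bot]
        exact Nat.zero_le m
      · exact Nat.le_of_lt_succ ((Submodule.finrank_lt_finrank_of_lt (inf_lt_left.2 hle)).trans_le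
          (hm W hW))
    obtain ⟨θ, hθ, hθ'⟩ := ih
      (h𝒲.image2 (fun W g => W ⊓ LinearMap.ker (l ∘ₗ ρ g)) Set.finite_univ)
      (by rintro _ ⟨W, hW, g, -, rfl⟩; exact finrank_le W hW g)
    refine ⟨Fin.cons (invariantNorm ρ (linearForm K Y l)) θ, ?_, fun W hW y hy h => ?_⟩
    · rw [Nat.card_eq_fintype_card] at hθ ⊢
      exact Fin.cases (invariantNorm_linearForm_mem ρ l) hθ
    · have hnorm := h 0
      rw [Fin.cons_zero, evalAt_invariantNorm, Finset.prod_eq_zero_iff] at hnorm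
      obtain ⟨g, -, hg⟩ := hnorm
      rw [evalAt_linearForm] at hg
      exact hθ' _ ⟨W, hW, g⁻¹, trivial, rfl⟩ y ⟨hy, hg⟩ fun j => h j.succ

section Reynolds

variable [Fintype G]

theorem sum_coordinateRingAct_mem (f : CoordinateRing K Y) :
    ∑ g : G, coordinateRingAct ρ g f ∈ invariantRing ρ := by
  refine mem_invariantRing.2 fun h => ?_
  rw [map_sum]
  refine Fintype.sum_equiv (Equiv.mulLeft h) _ _ fun g => ?_
  rw [Equiv.coe_mulLeft, coordinateRingAct_mul, AlgHom.comp_apply]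

/-- The Reynolds operator: the average of the translates of a function. -/
noncomputable def reynolds : CoordinateRing K Y →ₗ[invariantRing ρ] invariantRing ρ where
  toFun f := ⟨(Fintype.card G : K)⁻¹ • ∑ g : G, coordinateRingAct ρ g f,
    Subalgebra.smul_mem _ (sum_coordinateRingAct_mem ρ f) _⟩
  map_add' f f' := Subtype.ext (by simp only [map_add, Finset.sum_add_distrib, smul_add]; rfl)
  map_smul' a f := Subtype.ext (by
    simp only [coordinateRingAct_smul, ← Finset.smul_sum, smul_comm _ a]
    rfl)

theorem reynolds_algebraMap (hG : (Fintype.card G : K) ≠ 0) (f : invariantRing ρ) :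
    reynolds ρ (algebraMap _ _ f) = f := by
  refine Subtype.ext ?_
  change (Fintype.card G : K)⁻¹ • ∑ g : G, coordinateRingAct ρ g f.1 = f.1
  simp only [mem_invariantRing.1 f.2, Finset.sum_const, Finset.card_univ]
  rw [← Nat.cast_smul_eq_nsmul K, inv_smul_smul₀ hG]

end Reynolds

instance isNoetherianRing_invariantRing [CharZero K] [Finite G] [FiniteDimensional K Y] :
    IsNoetherianRing (invariantRing ρ) :=
  have := Fintype.ofFinite G
  isNoetherianRing_of_retraction
    (reynolds_algebraMap ρ (Nat.cast_ne_zero.2 Fintype.card_ne_zero))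

instance finiteDimensional_invariantRingDegree [FiniteDimensional K Y] (d : ℕ) :
    FiniteDimensional K (invariantRingDegree ρ d) :=
  FiniteDimensional.of_injective
    ((invariantRing ρ).val.toLinearMap.restrict
      (p := invariantRingDegree ρ d) (q := coordinateRingDegree K Y d) fun _ h => h)
    fun _ _ h => Subtype.ext (Subtype.ext
      (congrArg (fun f : coordinateRingDegree K Y d => f.1) h))

theorem exists_invariantRingDegree_le [IsAlgClosed K] [CharZero K] [Finite G]
    [FiniteDimensional K Y] {J : Ideal (invariantRing ρ)}
    (h : ∀ y : Y, (∀ a ∈ J, evalAt y (a : CoordinateRing K Y) = 0) → y = 0) :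
    ∃ n, ∀ d ≥ n, invariantRingDegree ρ d ≤ J.restrictScalars K := by
  have := Fintype.ofFinite G
  obtain ⟨n, hn⟩ := exists_coordinateRingDegree_le
    (J := J.map (algebraMap (invariantRing ρ) (CoordinateRing K Y)))
    fun y hy => h y fun a ha => hy _ (Ideal.mem_map_of_mem _ ha)
  refine ⟨n, fun d hd f hf => ?_⟩
  rw [Submodule.restrictScalars_mem, ← comap_map_eq_of_retraction
    (reynolds_algebraMap ρ (Nat.cast_ne_zero.2 Fintype.card_ne_zero)) J]
  exact hn d hd f hf

end Invariants

section CommonDenominator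

variable {K G Y : Type*} [Field K] [CharZero K] [Group G] [Finite G] [AddCommGroup Y] [Module K Y]
  [FiniteDimensional K Y] {ρ : Representation K G Y} {N : Ideal (invariantRing ρ)}

theorem exists_finset_invariants_forall_exists_apply_eq_smul (ρ : Representation K G Y) (w : K) :
    ∃ (s : Finset (invariantRing ρ)) (d : s → ℕ),
      (∀ a : s, w ^ d a ≠ 1 ∧ a.1 ∈ invariantRingDegree ρ (d a)) ∧
      ∀ y : Y, (∀ a : s, evalAt y a.1.1 = 0) → ∃ g, ρ g y = w • y := by
  let T : Set (invariantRing ρ) := {a | ∃ d, w ^ d ≠ 1 ∧ a ∈ invariantRingDegree ρ d}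
  obtain ⟨s, hsT, hs⟩ := (Submodule.fg_span_iff_fg_span_finset_subset T).1
    (IsNoetherian.noetherian (Ideal.span T))
  choose d hd using fun a : s => hsT a.2
  refine ⟨s, d, hd, fun y hy => exists_apply_eq_smul_of_evalAt_eq_zero ρ fun d hd a ha => ?_⟩
  have hle : Ideal.span T ≤ RingHom.ker ((evalAt y).comp (invariantRing ρ).val) :=
    hs.trans_le (Ideal.span_le.2 fun a ha => hy ⟨a, ha⟩)
  exact hle (Ideal.subset_span ⟨d, hd, ha⟩)

variable [IsAlgClosed K]

theorem prod_one_sub_X_pow_mem_denominatorIdeal_of_evalAt {ι : Type*} [Fintype ι]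
    {a : ι → invariantRing ρ} {d : ι → ℕ} (ha : ∀ i, a i ∈ invariantRingDegree ρ (d i))
    (h : ∀ y : Y, (∀ i, evalAt y (a i).1 = 0) → y = 0)
    (hN : N.IsHomogeneous (invariantRingDegree ρ)) :
    ∏ i, (1 - X ^ d i : ℤ[X]) ∈ denominatorIdeal (hilbertSeries (invariantRingDegree ρ) N) := by
  obtain ⟨n, hn⟩ := exists_invariantRingDegree_le ρ (J := Ideal.span (Set.range a))
    fun y hy => h y fun i => hy _ (Ideal.subset_span ⟨i, rfl⟩)
  rw [← sub_zero (hilbertSeries _ N), ← hilbertSeries_bot (invariantRingDegree ρ)]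
  refine prod_one_sub_X_pow_mem_denominatorIdeal Finset.univ (J := ⊥) (fun i _ => ha i) (n := n) ?_
    (Ideal.IsHomogeneous.bot _) hN bot_le (Ideal.mul_le_left (J := N))
  rwa [Finset.coe_univ, Set.image_univ, bot_sup_eq]

theorem exists_mem_denominatorIdeal_rootMultiplicity_le {w : K} {m : ℕ}
    (hm : ∀ g, Module.finrank K (Module.End.eigenspace (ρ g) w) ≤ m)
    (hN : N.IsHomogeneous (invariantRingDegree ρ)) :
    ∃ D ∈ denominatorIdeal ((hilbertSeries (invariantRingDegree ρ) N).map (Int.castRingHom K)),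
      D ≠ 0 ∧ D.rootMultiplicity w ≤ m := by
  classical
  obtain ⟨s, deg, hdeg, hs⟩ := exists_finset_invariants_forall_exists_apply_eq_smul ρ w
  obtain ⟨θ, hθ, hθ'⟩ := exists_invariants_separating ρ
    (Set.finite_range fun g => Module.End.eigenspace (ρ g) w) (Set.forall_mem_range.2 hm)
  let d : s ⊕ Fin m → ℕ := Sum.elim deg fun _ => Nat.card G
  have hd (i) : (d i : K) ≠ 0 := by
    rw [Nat.cast_ne_zero]
    rcases i with a | _
    · exact fun h => (hdeg a).1 (by rw [show deg a = 0 from h, pow_zero])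
    · exact Nat.card_pos.ne'
  have hmem := prod_one_sub_X_pow_mem_denominatorIdeal_of_evalAt (d := d)
    (a := Sum.elim (fun a : s => a.1) θ) (Sum.rec (fun a => (hdeg a).2) hθ)
    (fun y hy => by
      obtain ⟨g, hg⟩ := hs y fun a => hy (.inl a)
      exact hθ' _ ⟨g, rfl⟩ y (Module.End.mem_eigenspace_iff.2 hg) fun j => hy (.inr j)) hN
  rw [← map_mem_denominatorIdeal (RingHom.injective_int (Int.castRingHom K))] at hmem
  simp only [Polynomial.map_prod, Polynomial.map_sub, Polynomial.map_pow, Polynomial.map_X,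
    Polynomial.map_one] at hmem
  refine ⟨_, hmem, Finset.prod_ne_zero_iff.2 fun i _ => (separable_one_sub_X_pow (hd i)).ne_zero,
    ?_⟩
  have hsub : Finset.univ.filter (fun i => w ^ d i = 1) ⊆
      (Finset.univ : Finset (Fin m)).map Function.Embedding.inr := fun i hi => by
    rcases i with a | j
    · exact absurd (Finset.mem_filter.1 hi).2 (hdeg a).1
    · exact Finset.mem_map_of_mem _ (Finset.mem_univ j)
  rw [rootMultiplicity_prod_one_sub_X_pow hd, Fintype.card_subtype]
  exact (Finset.card_le_card hsub).trans_eq (by rw [Finset.card_map, Finset.card_fin])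

theorem mem_denominatorIdeal_of_finrank_eigenspace_le {B : ℤ[X]}
    (h : ∀ g w, Module.finrank K (Module.End.eigenspace (ρ g) w) ≤
      (B.map (Int.castRingHom K)).rootMultiplicity w)
    (hN : N.IsHomogeneous (invariantRingDegree ρ)) :
    B ∈ denominatorIdeal (hilbertSeries (invariantRingDegree ρ) N) :=
  (map_mem_denominatorIdeal (RingHom.injective_int (Int.castRingHom K))).1 <|
    mem_denominatorIdeal_of_rootMultiplicity_le fun w =>
      exists_mem_denominatorIdeal_rootMultiplicity_le (fun g => h g w) hN

end CommonDenominator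

section TranscendenceDegree

variable {K A B : Type*} [Field K] [CommRing A] [Algebra K A] [CommRing B] [Algebra K B]
  {𝒜 : ℕ → Submodule K A} {φ : A →ₐ[K] B}

theorem coeff_hilbertSeries_top_sub_ker (φ : A →ₐ[K] B) (n : ℕ) [FiniteDimensional K (𝒜 n)] :
    (hilbertSeries 𝒜 ⊤ - hilbertSeries 𝒜 (RingHom.ker φ)).coeff n =
      Module.finrank K ((𝒜 n).map φ.toLinearMap) := by
  have hker : idealDegree 𝒜 (RingHom.ker φ) n = 𝒜 n ⊓ LinearMap.ker φ.toLinearMap := inf_comm _ _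
  have htop : idealDegree 𝒜 ⊤ n = 𝒜 n := top_inf_eq _
  rw [map_sub, coeff_hilbertSeries, coeff_hilbertSeries, hker, htop,
    ← finrank_map_add_finrank_inf_ker (𝒜 n) φ.toLinearMap, Nat.cast_add, add_sub_cancel_right]

theorem card_le_finrank_of_algebraicIndependent {ι : Type*} [Fintype ι] {x : ι → B}
    (hx : AlgebraicIndependent K x) {W : Submodule K B} [FiniteDimensional K W]
    {T : Finset (ι → ℕ)} (hT : ∀ l ∈ T, ∏ i, x i ^ l i ∈ W) : T.card ≤ Module.finrank K W := by
  have hindep : LinearIndependent K fun l : ι → ℕ => ∏ i, x i ^ l i := by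
    have := ((MvPolynomial.basisMonomials ι K).linearIndependent.map'
      (MvPolynomial.aeval x).toLinearMap (LinearMap.ker_eq_bot.2 hx)).comp
        Finsupp.equivFunOnFinite.symm Finsupp.equivFunOnFinite.symm.injective
    convert! this using 2 with l
    change _ = MvPolynomial.aeval x (MvPolynomial.basisMonomials ι K _)
    rw [MvPolynomial.coe_basisMonomials, MvPolynomial.aeval_monomial, map_one, one_mul,
      Finsupp.prod_fintype _ _ fun _ => pow_zero _]
    simp only [Finsupp.coe_equivFunOnFinite_symm]
  have hW : LinearIndependent K fun l : T => (⟨_, hT l l.2⟩ : W) :=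
    LinearIndependent.of_comp W.subtype (hindep.comp _ Subtype.val_injective)
  exact (Fintype.card_coe T).symm.trans_le hW.fintype_card_le_finrank

theorem coeff_prod_geomSeries_le_finrank_map [SetLike.GradedMonoid 𝒜] {ι : Type*} [Fintype ι]
    {a : ι → A} {e : ι → ℕ} (ha : ∀ i, a i ∈ 𝒜 (e i)) (hφ : AlgebraicIndependent K (φ ∘ a)) (n : ℕ)
    [FiniteDimensional K (𝒜 n)] :
    (∏ i, geomSeries ℤ (e i)).coeff n ≤ Module.finrank K ((𝒜 n).map φ.toLinearMap) := by
  classical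
  rw [coeff_prod_geomSeries]
  set T := ((Finset.univ : Finset ι).finsuppAntidiag n).filter fun l => ∀ i, e i ∣ l i
  have mul_div {l} (hl : l ∈ T) (i : ι) : l i / e i * e i = l i :=
    Nat.div_mul_cancel ((Finset.mem_filter.1 hl).2 i)
  have hinj : Set.InjOn (fun (l : ι →₀ ℕ) i => l i / e i) T := fun l hl l' hl' h =>
    Finsupp.ext fun i => by
      rw [← mul_div hl, ← mul_div hl', show l i / e i = l' i / e i from congrFun h i]
  rw [← Finset.card_image_of_injOn hinj, Int.ofNat_le]
  refine card_le_finrank_of_algebraicIndependent hφ (Finset.forall_mem_image.2 fun l hl => ?_)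
  have hsum : ∑ i, (l i / e i) • e i = n := by
    simp only [smul_eq_mul, mul_div hl]
    exact (Finset.mem_finsuppAntidiag.1 (Finset.mem_filter.1 hl).1).1
  refine ⟨∏ i, a i ^ (l i / e i),
    hsum ▸ SetLike.prod_pow_mem_graded 𝒜 e a _ fun i _ => ha i, ?_⟩
  rw [AlgHom.toLinearMap_apply, map_prod]
  simp only [map_pow, Function.comp_apply]

theorem isIntegral_of_mem_degree_zero [SetLike.GradedMonoid 𝒜] [FiniteDimensional K (𝒜 0)] {a : A}
    (ha : a ∈ 𝒜 0) : IsIntegral K a :=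
  IsIntegral.of_mem_of_fg (SetLike.GradeZero.subalgebra 𝒜) (Module.Finite.iff_fg.1 ‹_›) a ha

theorem exists_isTranscendenceBasis_subset_image_homogeneous [IsDomain B] [GradedAlgebra 𝒜]
    [FiniteDimensional K (𝒜 0)] (hφ : φ.toRingHom.IsIntegral) :
    ∃ s ⊆ φ '' {a | ∃ d ≠ 0, a ∈ 𝒜 d}, IsTranscendenceBasis K ((↑) : s → B) := by
  let S := Algebra.adjoin K (φ '' {a | ∃ d, a ∈ 𝒜 d})
  have map_mem (a : A) : φ a ∈ S := by
    induction a using DirectSum.Decomposition.inductionOn 𝒜 with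
    | zero => rw [map_zero]; exact zero_mem S
    | add a b ha hb => rw [map_add]; exact add_mem ha hb
    | @homogeneous d a => exact Algebra.subset_adjoin ⟨a, ⟨d, a.2⟩, rfl⟩
  have : Algebra.IsIntegral S B :=
    ⟨RingHom.IsIntegral.tower_top (φ.codRestrict S map_mem).toRingHom (algebraMap S B) hφ⟩
  obtain ⟨s, hs, hsB⟩ := exists_isTranscendenceBasis_subset (R := K) (φ '' {a | ∃ d, a ∈ 𝒜 d})
  refine ⟨s, fun b hb => ?_, hsB⟩
  obtain ⟨a, ⟨d, ha⟩, rfl⟩ := hs hb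
  refine ⟨a, ⟨d, ?_, ha⟩, rfl⟩
  rintro rfl
  exact hsB.1.transcendental ⟨_, hb⟩ ((isIntegral_of_mem_degree_zero ha).map φ).isAlgebraic

theorem exists_coeff_prod_geomSeries_le_finrank_map [IsDomain B] [GradedAlgebra 𝒜]
    [∀ n, FiniteDimensional K (𝒜 n)] (hφ : φ.toRingHom.IsIntegral) {m : ℕ}
    (hm : Algebra.trdeg K B = m) :
    ∃ e : Fin m → ℕ, (∀ i, e i ≠ 0) ∧
      ∀ n, (∏ i, geomSeries ℤ (e i)).coeff n ≤ Module.finrank K ((𝒜 n).map φ.toLinearMap) := by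
  obtain ⟨s, hs, hsB⟩ := exists_isTranscendenceBasis_subset_image_homogeneous (𝒜 := 𝒜) hφ
  obtain ⟨σ⟩ := Cardinal.mk_eq_nat_iff.1 (hsB.cardinalMk_eq_trdeg.trans hm)
  choose a ha hφa using fun b : s => hs b.2
  choose e he hae using ha
  have hindep : AlgebraicIndependent K (φ ∘ a ∘ σ.symm) := by
    rw [← Function.comp_assoc, show φ ∘ a = (↑) from funext hφa]
    exact hsB.1.comp σ.symm σ.symm.injective
  exact ⟨e ∘ σ.symm, fun i => he _,
    fun n => coeff_prod_geomSeries_le_finrank_map (fun i => hae (σ.symm i)) hindep n⟩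

end TranscendenceDegree

section LowerBound

variable {K G Y : Type*} [Field K] [Group G] [AddCommGroup Y] [Module K Y]
  (ρ : Representation K G Y) (V : Submodule K Y)

/-- The restriction of invariant functions to a subspace. -/
noncomputable def restrictInvariants : invariantRing ρ →ₐ[K] CoordinateRing K V :=
  (coordinateRingMap V.subtype).comp (invariantRing ρ).val

theorem isHomogeneous_ker_restrictInvariants :
    (RingHom.ker (restrictInvariants ρ V)).IsHomogeneous (invariantRingDegree ρ) :=
  let φ : invariantRingDegree ρ →ₐᵍ[K] coordinateRingDegree K V :=
    { restrictInvariants ρ V with map_mem := coordinateRingMap_mem V.subtype }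
  (HomogeneousIdeal.comap φ.toGradedRingHom ⊥).isHomogeneous

theorem isIntegral_restrictInvariants [Finite G] :
    (restrictInvariants ρ V).toRingHom.IsIntegral :=
  RingHom.IsIntegral.trans _ _ (isIntegral_invariantRing ρ).isIntegral
    (RingHom.isIntegral_of_surjective _ (coordinateRingMap_subtype_surjective V))

variable {V}

theorem pow_smul_restrictInvariants {g : G} {w : K} (hV : V ≤ Module.End.eigenspace (ρ g) w) {d : ℕ}
    {f : invariantRing ρ} (hf : f ∈ invariantRingDegree ρ d) :
    w ^ d • restrictInvariants ρ V f = restrictInvariants ρ V f := by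
  have hcomp : V.subtype ∘ₗ (w • LinearMap.id) = ρ g ∘ₗ V.subtype := LinearMap.ext fun v =>
    (Module.End.mem_eigenspace_iff.1 (hV v.2)).symm
  have hinv := mem_invariantRing.1 f.2 g⁻¹
  rw [coordinateRingAct_eq, inv_inv] at hinv
  calc w ^ d • restrictInvariants ρ V f
      = coordinateRingMap (w • LinearMap.id) (coordinateRingMap V.subtype f.1) :=
        (coordinateRingMap_smul_id w (coordinateRingMap_mem V.subtype hf)).symm
    _ = coordinateRingMap (ρ g ∘ₗ V.subtype) f.1 := by
        rw [← hcomp, coordinateRingMap_comp, AlgHom.comp_apply]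
    _ = restrictInvariants ρ V f := by
        rw [coordinateRingMap_comp, AlgHom.comp_apply, hinv]
        rfl

theorem map_restrictInvariants_eq_bot {g : G} {w : K} (hV : V ≤ Module.End.eigenspace (ρ g) w)
    {d : ℕ} (hd : w ^ d ≠ 1) :
    (invariantRingDegree ρ d).map (restrictInvariants ρ V).toLinearMap = ⊥ := by
  rw [eq_bot_iff]
  rintro _ ⟨f, hf, rfl⟩
  have h : (w ^ d - 1) • restrictInvariants ρ V f = 0 := by
    rw [sub_smul, one_smul, pow_smul_restrictInvariants ρ hV hf, sub_self]
  exact (smul_eq_zero.1 h).resolve_left (sub_ne_zero.2 hd)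

theorem prod_one_sub_X_pow_card_mem_denominatorIdeal [IsAlgClosed K] [CharZero K] [Finite G]
    [FiniteDimensional K Y] {N : Ideal (invariantRing ρ)}
    (hN : N.IsHomogeneous (invariantRingDegree ρ)) :
    ∏ _i : Fin (Module.finrank K Y), (1 - X ^ Nat.card G : ℤ[X]) ∈
      denominatorIdeal (hilbertSeries (invariantRingDegree ρ) N) := by
  obtain ⟨θ, hθ, hθ'⟩ := exists_invariants_separating ρ (Set.finite_singleton (⊤ : Submodule K Y))
    (fun W hW => by rw [Set.mem_singleton_iff.1 hW, finrank_top])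
  exact prod_one_sub_X_pow_mem_denominatorIdeal_of_evalAt hθ (fun y => hθ' ⊤ rfl y trivial) hN

theorem finrank_le_rootMultiplicity_of_le_eigenspace [IsAlgClosed K] [CharZero K] [Finite G]
    [FiniteDimensional K Y] {g : G} {w : K} (hw : w ≠ 0) (hV : V ≤ Module.End.eigenspace (ρ g) w)
    {B : ℤ[X]} (hB : IsCommonDenominator (invariantRingDegree ρ) B) :
    Module.finrank K V ≤ (B.map (Int.castRingHom K)).rootMultiplicity w := by
  let φ := restrictInvariants ρ V
  have mem_denominatorIdeal_sub {D : ℤ[X]} (hD : ∀ N : Ideal (invariantRing ρ),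
      N.IsHomogeneous (invariantRingDegree ρ) → D ∈ denominatorIdeal (hilbertSeries _ N)) :
      D ∈ denominatorIdeal (hilbertSeries (invariantRingDegree ρ) ⊤ -
        hilbertSeries (invariantRingDegree ρ) (RingHom.ker φ)) :=
    denominatorIdeal_inf_le_sub ⟨hD _ (Ideal.IsHomogeneous.top _),
      hD _ (isHomogeneous_ker_restrictInvariants ρ V)⟩
  obtain ⟨e, he, hφe⟩ := exists_coeff_prod_geomSeries_le_finrank_map
    (𝒜 := invariantRingDegree ρ) (isIntegral_restrictInvariants ρ V) (trdeg_coordinateRing (Y := V))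
  have hB0 : B ≠ 0 := by
    rintro rfl
    exact zero_ne_one hB.1
  rw [← Fintype.card_fin (Module.finrank K V)]
  refine card_le_rootMultiplicity_of_mem_denominatorIdeal hw he (fun _ _ => Nat.card_pos.ne')
    (mem_denominatorIdeal_sub fun N => prod_one_sub_X_pow_card_mem_denominatorIdeal ρ)
    (fun n hn => ?_) (fun n => ?_) hB0
    (mem_denominatorIdeal_sub fun N hN => mem_denominatorIdeal.2 (hB.2 N hN))
  · rw [coeff_hilbertSeries_top_sub_ker, map_restrictInvariants_eq_bot ρ hV hn, finrank_bot,
      Nat.cast_zero]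
  · exact (hφe n).trans_eq (coeff_hilbertSeries_top_sub_ker φ n).symm

end LowerBound

section Determinants

theorem associated_charpolyRev_charpoly_inv {K ι : Type*} [Field K] [Fintype ι] [DecidableEq ι]
    {A : Matrix ι ι K} (hA : IsUnit A) : Associated A.charpolyRev A⁻¹.charpoly := by
  rw [Matrix.charpoly_inv A hA]
  refine (associated_unit_mul_left _ _ (.mul (isUnit_neg_one.pow _) ?_)).symm
  exact (((Matrix.isUnit_iff_isUnit_det A).1 hA).ringInverse).map C

theorem rootMultiplicity_eq_of_associated {R : Type*} [CommRing R] [IsDomain R] {p q : R[X]}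
    (hp : p ≠ 0) (h : Associated p q) (w : R) : p.rootMultiplicity w = q.rootMultiplicity w :=
  le_antisymm (rootMultiplicity_le_rootMultiplicity_of_dvd (h.ne_zero_iff.1 hp) h.dvd w)
    (rootMultiplicity_le_rootMultiplicity_of_dvd hp h.symm.dvd w)

variable {K G Y : Type*} [Field K] [Group G] [AddCommGroup Y] [Module K Y]
  (ρ : Representation K G Y)

theorem detOneSub_eq_charpolyRev {ι : Type*} [Fintype ι] [DecidableEq ι]
    (b : Module.Basis ι K Y) (g : G) :
    detOneSub ρ g = (LinearMap.toMatrix b b (ρ g)).charpolyRev := by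
  let b' := Algebra.TensorProduct.basis K[X] b
  have h : LinearMap.toMatrix b' b' (LinearMap.id - (X : K[X]) • (ρ g).baseChange K[X]) =
      1 - (X : K[X]) • (LinearMap.toMatrix b b (ρ g)).map C := by
    refine (_root_.map_sub (LinearMap.toMatrix b' b') _ _).trans ?_
    rw [LinearMap.toMatrix_id, LinearEquiv.map_smul, LinearMap.toMatrix_baseChange]
    rfl
  rw [detOneSub, ← LinearMap.det_toMatrix b', Matrix.charpolyRev, h]

theorem associated_detOneSub_charpoly [FiniteDimensional K Y] (g : G) :
    Associated (detOneSub ρ g) (ρ g⁻¹).charpoly := by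
  let b := Module.finBasis K Y
  have hmul : LinearMap.toMatrix b b (ρ g⁻¹) * LinearMap.toMatrix b b (ρ g) = 1 := by
    rw [← LinearMap.toMatrix_mul, ← map_mul, inv_mul_cancel, map_one, LinearMap.toMatrix_one]
  rw [detOneSub_eq_charpolyRev ρ b, ← LinearMap.charpoly_toMatrix (ρ g⁻¹) b,
    ← Matrix.inv_eq_left_inv hmul]
  exact associated_charpolyRev_charpoly_inv (IsUnit.of_mul_eq_one_right _ hmul)

theorem detOneSub_ne_zero [FiniteDimensional K Y] (g : G) : detOneSub ρ g ≠ 0 :=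
  (associated_detOneSub_charpoly ρ g).ne_zero_iff.2 (LinearMap.charpoly_monic _).ne_zero

theorem isSemisimple_of_card_ne_zero (hG : (Nat.card G : K) ≠ 0) (g : G) :
    Module.End.IsSemisimple (ρ g) := by
  refine Module.End.isSemisimple_of_squarefree_aeval_eq_zero (p := X ^ Nat.card G - 1)
    (X_pow_sub_one_separable_iff.2 hG).squarefree ?_
  rw [map_sub, map_pow, aeval_X, map_one, ← map_pow, pow_card_eq_one', map_one, sub_self]

theorem rootMultiplicity_detOneSub [FiniteDimensional K Y] (hG : (Nat.card G : K) ≠ 0) (g : G)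
    (w : K) :
    (detOneSub ρ g).rootMultiplicity w = Module.finrank K (Module.End.eigenspace (ρ g⁻¹) w) := by
  rw [rootMultiplicity_eq_of_associated (detOneSub_ne_zero ρ g) (associated_detOneSub_charpoly ρ g),
    ← LinearMap.finrank_maxGenEigenspace_eq,
    (isSemisimple_of_card_ne_zero ρ hG g⁻¹).isFinitelySemisimple.maxGenEigenspace_eq_eigenspace]

end Determinants

section MaxEigenspaceRank

variable {K G Y : Type*} [Field K] [Group G] [AddCommGroup Y] [Module K Y]
  (ρ : Representation K G Y)

/-- The largest dimension of the `w`-eigenspace of an element of `G`. -/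
noncomputable def maxEigenspaceRank (w : K) : ℕ :=
  ⨆ g, Module.finrank K (Module.End.eigenspace (ρ g) w)

theorem eigenspace_le_eigenspace_pow (g : G) (w : K) (i : ℕ) :
    Module.End.eigenspace (ρ g) w ≤ Module.End.eigenspace (ρ (g ^ i)) (w ^ i) := by
  intro v hv
  rw [Module.End.mem_eigenspace_iff] at hv ⊢
  induction i with
  | zero => simp
  | succ i ih =>
    rw [pow_succ, map_mul, Module.End.mul_apply, hv, map_smul, ih, smul_smul, pow_succ, mul_comm]

theorem maxEigenspaceRank_eq_zero {w : K} (hw : w ^ Nat.card G ≠ 1) :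
    maxEigenspaceRank ρ w = 0 := by
  refine Nat.le_zero.1 (ciSup_le' fun g => ?_)
  suffices h : Module.End.eigenspace (ρ g) w = ⊥ by rw [h, finrank_bot]
  refine (Submodule.eq_bot_iff _).2 fun v hv => ?_
  have hv' := eigenspace_le_eigenspace_pow ρ g w (Nat.card G) hv
  rw [pow_card_eq_one', map_one, Module.End.mem_eigenspace_iff, Module.End.one_apply] at hv'
  have h : (1 - w ^ Nat.card G) • v = 0 := by rw [sub_smul, one_smul, ← hv', sub_self]
  exact (smul_eq_zero.1 h).resolve_left (sub_ne_zero.2 (Ne.symm hw))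

variable [Finite G]

theorem finrank_eigenspace_le_maxEigenspaceRank (g : G) (w : K) :
    Module.finrank K (Module.End.eigenspace (ρ g) w) ≤ maxEigenspaceRank ρ w :=
  le_ciSup (f := fun g => Module.finrank K (Module.End.eigenspace (ρ g) w))
    (Set.finite_range _).bddAbove g

theorem maxEigenspaceRank_le_pow [FiniteDimensional K Y] (w : K) (i : ℕ) :
    maxEigenspaceRank ρ w ≤ maxEigenspaceRank ρ (w ^ i) :=
  ciSup_le' fun g => (Submodule.finrank_mono (eigenspace_le_eigenspace_pow ρ g w i)).trans
    (finrank_eigenspace_le_maxEigenspaceRank ρ (g ^ i) (w ^ i))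

theorem maxEigenspaceRank_factorsThrough_orderOf [FiniteDimensional K Y] :
    Function.FactorsThrough (maxEigenspaceRank ρ) orderOf := by
  have pow_card_ne_one {w : K} (hw : orderOf w = 0) : w ^ Nat.card G ≠ 1 := fun h =>
    Nat.card_pos.ne' (Nat.eq_zero_of_zero_dvd (hw ▸ orderOf_dvd_of_pow_eq_one h))
  intro w w' h
  by_cases hw : orderOf w = 0
  · rw [maxEigenspaceRank_eq_zero ρ (pow_card_ne_one hw),
      maxEigenspaceRank_eq_zero ρ (pow_card_ne_one (h ▸ hw))]
  have le_of_orderOf_eq {w w' : K} (hw : orderOf w ≠ 0) (h : orderOf w = orderOf w') :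
      maxEigenspaceRank ρ w ≤ maxEigenspaceRank ρ w' := by
    have : NeZero (orderOf w) := ⟨hw⟩
    obtain ⟨i, -, rfl⟩ := (IsPrimitiveRoot.orderOf w).eq_pow_of_pow_eq_one
      (h ▸ pow_orderOf_eq_one w')
    exact maxEigenspaceRank_le_pow ρ w i
  exact le_antisymm (le_of_orderOf_eq hw h) (le_of_orderOf_eq (h ▸ hw) h.symm)

theorem maxEigenspaceRank_le_rootMultiplicity [IsAlgClosed K] [CharZero K] [FiniteDimensional K Y]
    {B : ℤ[X]} (hB : IsCommonDenominator (invariantRingDegree ρ) B) (w : K) :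
    maxEigenspaceRank ρ w ≤ (B.map (Int.castRingHom K)).rootMultiplicity w := by
  rcases eq_or_ne w 0 with rfl | hw
  · rw [maxEigenspaceRank_eq_zero ρ (by rw [zero_pow Nat.card_pos.ne']; exact zero_ne_one)]
    exact Nat.zero_le _
  · exact ciSup_le' fun g => finrank_le_rootMultiplicity_of_le_eigenspace ρ hw le_rfl hB

end MaxEigenspaceRank

theorem mainTheorem4 {K G Y : Type*} [Field K] [IsAlgClosed K] [CharZero K]
    [Group G] [Finite G] [AddCommGroup Y] [Module K Y] [FiniteDimensional K Y]
    (ρ : Representation K G Y) :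
    ∃ B : ℤ[X], IsUniversalDenominator (invariantRingDegree ρ) B ∧
      IsLeastCommonMultiple (Set.range (detOneSub ρ)) (B.map (Int.castRingHom K)) := by
  obtain ⟨B, hBunit, hB0, hB⟩ := exists_int_polynomial_rootMultiplicity_eq
    (Nat.card_pos (α := G)).ne' (fun w => maxEigenspaceRank_eq_zero ρ)
    (maxEigenspaceRank_factorsThrough_orderOf ρ)
  have hG : (Nat.card G : K) ≠ 0 := Nat.cast_ne_zero.2 Nat.card_pos.ne'
  have map_ne_zero : B.map (Int.castRingHom K) ≠ 0 :=
    (Polynomial.map_ne_zero_iff (RingHom.injective_int _)).2 (leadingCoeff_ne_zero.1 hBunit.ne_zero)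
  refine ⟨B, ⟨⟨hB0, fun N hN => ?_⟩, fun B' hB' => ?_⟩, ?_, fun q hq => ?_⟩
  · exact mem_denominatorIdeal.1 (mem_denominatorIdeal_of_finrank_eigenspace_le
      (fun g w => hB w ▸ finrank_eigenspace_le_maxEigenspaceRank ρ g w) hN)
  · refine dvd_of_map_dvd_map (RingHom.injective_int (Int.castRingHom K)) hBunit ?_
    exact dvd_of_rootMultiplicity_le map_ne_zero fun w =>
      hB w ▸ maxEigenspaceRank_le_rootMultiplicity ρ hB' w
  · rintro _ ⟨g, rfl⟩
    refine dvd_of_rootMultiplicity_le (detOneSub_ne_zero ρ g) fun w => ?_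
    rw [rootMultiplicity_detOneSub ρ hG, hB]
    exact finrank_eigenspace_le_maxEigenspaceRank ρ g⁻¹ w
  · rcases eq_or_ne q 0 with rfl | hq0
    · exact dvd_zero _
    refine dvd_of_rootMultiplicity_le map_ne_zero fun w => hB w ▸ ciSup_le' fun g => ?_
    rw [← inv_inv g, ← rootMultiplicity_detOneSub ρ hG]
    exact rootMultiplicity_le_rootMultiplicity_of_dvd hq0 (hq _ ⟨g⁻¹, rfl⟩) w
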